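/- Let $n\ge 2$, $d\ge 0$. Let $f_1,\dots,f_n:\mathbb R^d\to\mathbb R$ be convex, $f_i$ Lipschitz with constant $L_i$ for the Euclidean norm $\|\cdot\|$, $L=\sum_i L_i$, $F=\sum_i f_i$, and let $Z^*$ be the set of minimizers of $F$. **Graphs.** Let $\bar G(0),\bar G(1),\dots$ be independent random directed graphs on $[n]$ with self-loops at all nodes, such that for every $t$ one has $\Pr(\bar G(t)=b)=p_b$ for every directed graph $b$ on $[n]$ with all self-loops, and such that $\bigcup_{b:\,p_b>0} b$ is strongly connected. **Algorithm (modified subgradient-push).** Let $\delta=n^{-2n}$, $\alpha(t)=t^{-\gamma}$ with $\tfrac12<\gamma<1$, $y_i(0)=1$, and let $\mathbf x_i(0)\in\mathbb R^d$ be deterministic. At time $t$ the effective graph $G(t)$ is obtained from $\bar G(t)$ by deleting the edges from $j$ to other nodes for every $j$ with $y_j(t)<\delta$; all self-loops are kept. With $N_i^{\rm in}(t)$ the in-neighbors of $i$ and $d_j(t)$ the out-degree of $j$ in $G(t)$ (self-loops included), for $t\ge 0$ $$\mathbf w_i(t+1)=\sum_{j\in N_i^{\rm in}(t)}\frac{\mathbf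 x_j(t)}{d_j(t)},\qquad y_i(t+1)=\sum_{j\in N_i^{\rm in}(t)}\frac{y_j(t)}{d_j(t)},$$ $$\mathbf z_i(t+1)=\frac{\mathbf w_i(t+1)}{y_i(t+1)},\qquad \mathbf x_i(t+1)=\mathbf w_i(t+1)-\alpha(t+1)\mathbf g_i(t+1),$$ where $\mathbf g_i(t+1)$ is a (measurably chosen) subgradient of $f_i$ at $\mathbf z_i(t+1)$. Put $S(0)=0$, $S(t)=\sum_{s=0}^{t-1}\alpha(s+1)$ for $t\ge 1$, and, from any $\tilde{\mathbf z}_i(0)\in\mathbb R^d$, let $$\tilde{\mathbf z}_i(t+1)=\frac{\alpha(t+1)\mathbf z_i(t+1)+S(t)\tilde{\mathbf z}_i(t)}{S(t+1)},\qquad t\ge 0.$$ **Conclusion.** Let $B=2n-2$, $p=(\min_{b:\,p_b>0}p_b)^{2n-2}$, $\lambda=\bigl(1-n^{-4nB/p}\bigr)^{p/(2nB)}$, $\bar{\mathbf x}(0)=\frac1n\sum_j\mathbf x_j(0)$, and let $\|\cdot\|_1$ be the $1$-norm. Then for all $t\ge1$, $i\in[n]$ and $\mathbf z^*\in Z^*$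 the random variable $F(\tilde{\mathbf z}_i(t+1))$ is integrable and $$\mathbb E\bigl[F(\tilde{\mathbf z}_i(t+1))-F(\mathbf z^*)\bigr]\le\Gamma\left[\frac{n\|\bar{\mathbf x}(0)-\mathbf z^*\|^2}{2}+\Bigl(1+\frac1{2\gamma-1}\Bigr)\frac{L^2}{2n}+\frac{60L\sum_{j=1}^n\|\mathbf x_j(0)\|_1}{\delta(1-\lambda)}+\frac{60dL^2}{\delta(1-\lambda)}\Bigl(1+\frac1{2\gamma-1}\Bigr)\right],$$ where $\Gamma=\dfrac{1-\gamma}{(t+2)^{1-\gamma}-1}$. In particular, $\mathbb E[F(\tilde{\mathbf z}_i(t+1))-F(\mathbf z^*)]=O(t^{-(1-\gamma)})$ as $t\to\infty$. -/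

import Mathlib

open MeasureTheory ProbabilityTheory

noncomputable section

namespace MSP

/-! ### Graphs on the node set `Fin n` -/

/-- Directed graphs on `n` nodes having a self-loop at every node. -/
def LoopDigraph (n : ℕ) : Type := {G : Digraph (Fin n) // ∀ v, G.Adj v v}

/-- The finite set of these graphs carries the discrete sigma-algebra. -/
instance (n : ℕ) : MeasurableSpace (LoopDigraph n) := ⊤

open Classical in
/-- In-neighbours of `i`: the nodes `j` with an edge `j → i`. -/
def inNeighbors {n : ℕ} (H : Digraph (Fin n)) (i : Fin n) : Finset (Fin n) :=
  {j | H.Adj j i}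

open Classical in
/-- Out-degree of `j`: the number of nodes `i` with an edge `j → i` (a self-loop counts). -/
def outDegree {n : ℕ} (H : Digraph (Fin n)) (j : Fin n) : ℕ :=
  Finset.card {i : Fin n | H.Adj j i}

/-- There is a directed path between any two nodes. -/
def StronglyConnected {n : ℕ} (H : Digraph (Fin n)) : Prop :=
  ∀ u v, Relation.ReflTransGen H.Adj u v

/-- The union of all graphs to which `p` gives a positive probability. -/
def unionGraph {n : ℕ} (p : LoopDigraph n → ℝ) : Digraph (Fin n) where
  Adj u v := ∃ b : LoopDigraph n, 0 < p b ∧ b.1.Adj u v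

/-- The assumption on the random graphs of available channels: each `G t` equals the graph `b`
with probability `p b`, the graphs are independent, and the union of the graphs of positive
probability is strongly connected. -/
structure RandomGraphAssumption {n : ℕ} {Ω : Type*} [MeasurableSpace Ω] (μ : Measure Ω)
    (G : ℕ → Ω → LoopDigraph n) (p : LoopDigraph n → ℝ) : Prop where
  measurable : ∀ t, Measurable (G t)
  prob : ∀ t b, μ.real {ω | G t ω = b} = p b
  connected : StronglyConnected (unionGraph p)
  indep : iIndepFun G μ

/-! ### The modified subgradient-push algorithm, along one realization

`G t` is the graph of available channels at time `t`, `g t i` is the subgradient used by node `i`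
at time `t` (only `t ≥ 1` matters) and `x0` are the initial states. -/

/-- The threshold `δ = n^{-2n}`. -/
def delta (n : ℕ) : ℝ := 1 / (n : ℝ) ^ (2 * n)

/-- The effective graph: a node `j` with `y j < δ` does not send to the other nodes, and every
node keeps its self-loop. -/
def effectiveGraph {n : ℕ} (G : LoopDigraph n) (y : Fin n → ℝ) : Digraph (Fin n) where
  Adj j i := G.1.Adj j i ∧ (j = i ∨ delta n ≤ y j)

/-- One round of push averaging: every node splits its value evenly among its out-neighbours. -/
def push {n : ℕ} {V : Type*} [AddCommGroup V] [Module ℝ V] (H : Digraph (Fin n))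
    (v : Fin n → V) (i : Fin n) : V :=
  ∑ j ∈ inNeighbors H i, (1 / (outDegree H j : ℝ)) • v j

/-- The scalar weights `y_i(t)`. -/
def y {n : ℕ} (G : ℕ → LoopDigraph n) : ℕ → Fin n → ℝ
  | 0 => fun _ => 1
  | t + 1 => push (effectiveGraph (G t) (y G t)) (y G t)

/-- The step sizes `α(t) = t^{-γ}`. -/
def alpha (γ : ℝ) (t : ℕ) : ℝ := 1 / (t : ℝ) ^ γ

section Vector

variable {n d : ℕ} (γ : ℝ) (G : ℕ → LoopDigraph n)
  (g : ℕ → Fin n → EuclideanSpace ℝ (Fin d)) (x0 : Fin n → EuclideanSpace ℝ (Fin d))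

/-- The states `x_i(t)`. -/
def x : ℕ → Fin n → EuclideanSpace ℝ (Fin d)
  | 0 => x0
  | t + 1 => fun i =>
      push (effectiveGraph (G t) (y G t)) (x t) i - alpha γ (t + 1) • g (t + 1) i

/-- The vectors `w_i(t)` for `t ≥ 1` (the value at `0` is a convention and is not used). -/
def w : ℕ → Fin n → EuclideanSpace ℝ (Fin d)
  | 0 => x0
  | t + 1 => push (effectiveGraph (G t) (y G t)) (x γ G g x0 t)

/-- The estimates `z_i(t) = w_i(t) / y_i(t)`, for `t ≥ 1`. -/
def z (t : ℕ) (i : Fin n) : EuclideanSpace ℝ (Fin d) :=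
  (1 / y G t i) • w γ G g x0 t i

/-- `S(t) = ∑_{s=0}^{t-1} α(s+1)`, in particular `S(0) = 0`. -/
def S (t : ℕ) : ℝ := ∑ s ∈ Finset.range t, alpha γ (s + 1)

/-- The running weighted averages of the estimates, started at `zt0`. -/
def zTilde (zt0 : Fin n → EuclideanSpace ℝ (Fin d)) : ℕ → Fin n → EuclideanSpace ℝ (Fin d)
  | 0 => zt0
  | t + 1 => fun i =>
      (1 / S γ (t + 1)) • (alpha γ (t + 1) • z γ G g x0 (t + 1) i + S γ t • zTilde zt0 t i)

end Vector

/-! ### The optimization problem and the constants of the bound -/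

/-- `v` is a subgradient of `f` at `a`. -/
def IsSubgradientAt {d : ℕ} (f : EuclideanSpace ℝ (Fin d) → ℝ)
    (v a : EuclideanSpace ℝ (Fin d)) : Prop :=
  ∀ b, f a + inner ℝ v (b - a) ≤ f b

/-- The global objective `F = ∑ i, f i`. -/
def objective {n d : ℕ} (f : Fin n → EuclideanSpace ℝ (Fin d) → ℝ)
    (a : EuclideanSpace ℝ (Fin d)) : ℝ := ∑ i, f i a

/-- The set of minimizers of the objective. -/
def minimizers {n d : ℕ} (f : Fin n → EuclideanSpace ℝ (Fin d) → ℝ) :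
    Set (EuclideanSpace ℝ (Fin d)) := {a | ∀ b, objective f a ≤ objective f b}

/-- The `1`-norm of a vector. -/
def norm1 {d : ℕ} (v : EuclideanSpace ℝ (Fin d)) : ℝ := ∑ l, |v l|

/-- The average `(1/n) ∑ i, v i`. -/
def average {n d : ℕ} (v : Fin n → EuclideanSpace ℝ (Fin d)) : EuclideanSpace ℝ (Fin d) :=
  (1 / (n : ℝ)) • ∑ i, v i

/-- The minimum of the positive values of `p`, raised to the power `2n-2`. -/
def pConn {n : ℕ} (p : LoopDigraph n → ℝ) : ℝ :=
  (⨅ b : {b : LoopDigraph n // 0 < p b}, p b.1) ^ (2 * n - 2)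

/-- `λ = (1 - n^{-4nB/p})^{p/(2nB)}` with `B = 2n-2` and `p = pConn`. -/
def lam {n : ℕ} (p : LoopDigraph n → ℝ) : ℝ :=
  (1 - 1 / (n : ℝ) ^ (4 * n * (2 * n - 2) / pConn p)) ^ (pConn p / (2 * n * (2 * n - 2)))

/-- `Γ = (1-γ) / ((t+2)^{1-γ} - 1)`. -/
def Gam (γ : ℝ) (t : ℕ) : ℝ := (1 - γ) / (((t : ℝ) + 2) ^ (1 - γ) - 1)

end MSP

end

/-!
The weights `y` and the values `v` of any quantity spread by the algorithm are multiplied by the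
same column-stochastic matrices, so the ratios `v i / y i` are replaced, at each step, by averages
of themselves: the diameter of the set of ratios never grows. It shrinks as follows. The weights sum
to `n`, so at each time `t` some node `r` has weight at least `1`. There is a sequence of `n - 1`
graphs of positive probability along which a value held by `r` reaches every node
(`exists_reach_eq_univ`). If these graphs occur, then `r` leaves at least `n^{-k}` at all nodes
reached after `k` steps. Since this is at least `δ`, the threshold does not stop the spreading, and
after `n - 1` steps every new ratio is an average that gives weight at least `n^{-n}` to the old
ratio of `r`. Hence the diameter contracts by `1 - n^{-n}` (`RatiosWithin.window`).

The heavy node depends on the past, the next `n - 1` graphs do not. So, with `π` the smallest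
positive probability of a graph, the contraction factor over `K` consecutive windows of length
`n - 1` has expectation at most `(1 - π^{n-1} n^{-n})^K` (`integral_factor_le`).

The state is the superposition of the transported initial state and the transported subgradient
steps (`w_eq`), and the subgradients are bounded by the Lipschitz constants, whatever their
dependence on the graphs. Adding up the diameters bounds the disagreement of the estimates
`z_i(t + 1)` by a sum of contraction factors with deterministic coefficients (`norm_z_sub_z_le`).
The average of the states performs a subgradient step with subgradients taken at points which are
as close to it as this disagreement; the usual telescoping of squared distances and the convexity of
`F` give the bound along each realization (`objective_zTilde_sub_le`). Taking expectations, the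
disagreements weighted by the step sizes sum to at most a multiple of `(n - 1) / (π^{n-1} n^{-n})`.
This is smaller than the constants with `1 - λ` in the denominator, because `1 - λ ≤ n^{-4nB/p}` is
minute (`gap_comparison`).
-/

namespace MSP

open scoped Matrix.Module

/-! ### Push averaging as multiplication by a column-stochastic matrix -/

open Classical in
/-- The matrix of one round of push averaging over the graph `H`. -/
noncomputable def weight {n : ℕ} (H : Digraph (Fin n)) : Matrix (Fin n) (Fin n) ℝ :=
  fun i j => if H.Adj j i then 1 / (outDegree H j : ℝ) else 0

lemma push_eq_smul {n : ℕ} {V : Type*} [AddCommGroup V] [Module ℝ V] (H : Digraph (Fin n))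
    (v : Fin n → V) : push H v = weight H • v := by
  classical
  funext i
  simp [push, weight, inNeighbors, Finset.sum_filter, ite_smul]

lemma weight_nonneg {n : ℕ} (H : Digraph (Fin n)) (i j : Fin n) : 0 ≤ weight H i j := by
  unfold weight; split_ifs <;> positivity

lemma sum_weight {n : ℕ} {H : Digraph (Fin n)} {j : Fin n} (h : H.Adj j j) :
    ∑ i, weight H i j = 1 := by
  classical
  have hpos : (outDegree H j : ℝ) ≠ 0 := by
    have : 0 < outDegree H j := Finset.card_pos.2 ⟨j, by simpa using h⟩
    positivity
  unfold weight
  rw [← Finset.sum_filter, Finset.sum_const, nsmul_eq_mul]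
  exact mul_one_div_cancel hpos

lemma one_div_le_weight {n : ℕ} {H : Digraph (Fin n)} {i j : Fin n} (h : H.Adj j i) :
    1 / (n : ℝ) ≤ weight H i j := by
  classical
  have hpos : 0 < outDegree H j := Finset.card_pos.2 ⟨i, by simpa using h⟩
  have hle : outDegree H j ≤ n := (Finset.card_le_univ _).trans_eq (Fintype.card_fin n)
  rw [weight, if_pos h]
  exact one_div_le_one_div_of_le (by positivity) (by exact_mod_cast hle)

/-- The matrix by which the algorithm passes from time `t` to time `t + 1`. -/
noncomputable def stepMatrix {n : ℕ} (G : ℕ → LoopDigraph n) (t : ℕ) : Matrix (Fin n) (Fin n) ℝ :=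
  weight (effectiveGraph (G t) (y G t))

/-- The product of `k` successive step matrices, starting at time `s`. -/
noncomputable def transition {n : ℕ} (G : ℕ → LoopDigraph n) (s : ℕ) :
    ℕ → Matrix (Fin n) (Fin n) ℝ
  | 0 => 1
  | k + 1 => stepMatrix G (s + k) * transition G s k

section Path

variable {n : ℕ} (G : ℕ → LoopDigraph n)

lemma effectiveGraph_adj_self (t : ℕ) (v : Fin n → ℝ) (j : Fin n) :
    (effectiveGraph (G t) v).Adj j j := ⟨(G t).2 j, Or.inl rfl⟩

lemma y_succ (t : ℕ) : y G (t + 1) = stepMatrix G t • y G t := push_eq_smul _ _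

lemma transition_smul_y (s k : ℕ) : transition G s k • y G s = y G (s + k) := by
  induction k with
  | zero => simp [transition]
  | succ k ih => rw [transition, mul_smul, ih, ← add_assoc, y_succ]

lemma transition_add (s k l : ℕ) :
    transition G s (k + l) = transition G (s + k) l * transition G s k := by
  induction l with
  | zero => simp [transition]
  | succ l ih => rw [← add_assoc, transition, ih, transition, mul_assoc, add_assoc]

lemma stepMatrix_nonneg (t : ℕ) (i j : Fin n) : 0 ≤ stepMatrix G t i j := weight_nonneg _ _ _

lemma transition_nonneg (s k : ℕ) (i j : Fin n) : 0 ≤ transition G s k i j := by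
  induction k generalizing i with
  | zero => simp only [transition, Matrix.one_apply]; split_ifs <;> norm_num
  | succ k ih =>
    rw [transition, Matrix.mul_apply]
    exact Finset.sum_nonneg fun l _ => mul_nonneg (stepMatrix_nonneg G _ i l) (ih l)

lemma sum_stepMatrix (t : ℕ) (j : Fin n) : ∑ i, stepMatrix G t i j = 1 :=
  sum_weight (effectiveGraph_adj_self G t _ j)

lemma sum_stepMatrix_smul {V : Type*} [AddCommGroup V] [Module ℝ V] (t : ℕ) (v : Fin n → V) :
    ∑ i, (stepMatrix G t • v) i = ∑ j, v j := by
  simp only [Matrix.Module.smul_apply]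
  rw [Finset.sum_comm]
  exact Finset.sum_congr rfl fun j _ => by rw [← Finset.sum_smul, sum_stepMatrix, one_smul]

lemma sum_y (t : ℕ) : ∑ i, y G t i = n := by
  induction t with
  | zero => simp [y]
  | succ t ih => rw [y_succ, sum_stepMatrix_smul, ih]

lemma y_nonneg (t : ℕ) (i : Fin n) : 0 ≤ y G t i := by
  induction t generalizing i with
  | zero => simp [y]
  | succ t ih =>
    rw [y_succ]
    exact Finset.sum_nonneg fun j _ => mul_nonneg (stepMatrix_nonneg G t i j) (ih j)

lemma y_le (t : ℕ) (i : Fin n) : y G t i ≤ n := by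
  rw [← sum_y G t]
  exact Finset.single_le_sum (fun k _ => y_nonneg G t k) (Finset.mem_univ i)

/-- A node below the threshold keeps its whole weight, so no weight falls below `δ / n`. -/
lemma delta_div_le_y (hn : 2 ≤ n) (t : ℕ) (i : Fin n) : delta n / n ≤ y G t i := by
  have hn1 : (1 : ℝ) ≤ n := by exact_mod_cast (by omega : 1 ≤ n)
  have hδ : 0 < delta n := by unfold delta; positivity
  induction t with
  | zero =>
    have : delta n ≤ 1 := by
      unfold delta
      rw [div_le_one (by positivity)]
      exact one_le_pow₀ hn1
    exact (div_le_self hδ.le hn1).trans this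
  | succ t ih =>
    have hself : stepMatrix G t i i * y G t i ≤ y G (t + 1) i := by
      rw [y_succ]
      exact Finset.single_le_sum (f := fun j => stepMatrix G t i j * y G t j)
        (fun j _ => mul_nonneg (stepMatrix_nonneg G t i j) (y_nonneg G t j)) (Finset.mem_univ i)
    refine le_trans ?_ hself
    rcases le_or_gt (delta n) (y G t i) with h | h
    · have := one_div_le_weight (effectiveGraph_adj_self G t (y G t) i)
      calc delta n / n = 1 / n * delta n := by ring
        _ ≤ stepMatrix G t i i * y G t i :=
          mul_le_mul this h hδ.le (stepMatrix_nonneg G t i i)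
    -- Below the threshold `i` sends to itself only, so its column is a unit vector.
    · have hone : stepMatrix G t i i = 1 := by
        have hz : ∀ k, k ≠ i → stepMatrix G t k i = 0 := fun k hk => by
          unfold stepMatrix weight
          rw [if_neg]
          rintro ⟨-, rfl | h'⟩
          · exact hk rfl
          · exact absurd h' (not_le.2 h)
        rw [← sum_stepMatrix G t i]
        exact (Finset.sum_eq_single i (fun k _ hk => hz k hk) (by simp)).symm
      rw [hone, one_mul]
      exact ih

lemma y_pos (hn : 2 ≤ n) (t : ℕ) (i : Fin n) : 0 < y G t i :=
  lt_of_lt_of_le (by unfold delta; positivity) (delta_div_le_y G hn t i)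

lemma exists_one_le_y (hn : 2 ≤ n) (t : ℕ) : ∃ r, 1 ≤ y G t r := by
  have : Nonempty (Fin n) := ⟨⟨0, by omega⟩⟩
  obtain ⟨r, -, hr⟩ := Finset.exists_le_of_sum_le (s := Finset.univ) (f := fun _ : Fin n => (1 : ℝ))
    (g := y G t) Finset.univ_nonempty (by rw [sum_y]; simp)
  exact ⟨r, hr⟩

end Path

/-! ### Contraction of the ratios -/

/-- The ratios `v i / w i` are within distance `D` of each other. With `w = y G t` these are the
estimates which the nodes extract from the transported values `v`. -/
def RatiosWithin {n : ℕ} {V : Type*} [NormedAddCommGroup V] [NormedSpace ℝ V]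
    (w : Fin n → ℝ) (v : Fin n → V) (D : ℝ) : Prop :=
  ∀ i j, ‖(1 / w i) • v i - (1 / w j) • v j‖ ≤ D

/-- Two averages of the same vectors which share a common mass `c` at one of them are closer than
the vectors by the factor `1 - c` at least. -/
lemma norm_average_sub_average_le {ι V : Type*} [Fintype ι] [NormedAddCommGroup V]
    [NormedSpace ℝ V] {a b : ι → ℝ} {u : ι → V} {D c : ℝ} {r : ι} (ha : ∀ j, 0 ≤ a j)
    (hb : ∀ j, 0 ≤ b j) (ha1 : ∑ j, a j = 1) (hb1 : ∑ j, b j = 1) (har : c ≤ a r)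
    (hbr : c ≤ b r) (hu : ∀ j l, ‖u j - u l‖ ≤ D) :
    ‖∑ j, a j • u j - ∑ j, b j • u j‖ ≤ (1 - c) * D := by
  classical
  -- The common mass `c` at `r` cancels in the difference; `a'` and `b'` are what remains.
  set a' : ι → ℝ := fun j => a j - if j = r then c else 0 with ha'
  set b' : ι → ℝ := fun j => b j - if j = r then c else 0 with hb'
  have ha'0 : ∀ j, 0 ≤ a' j := fun j => by
    simp only [ha']; split_ifs with h
    · subst h; linarith
    · simpa using ha j
  have hb'0 : ∀ j, 0 ≤ b' j := fun j => by
    simp only [hb']; split_ifs with h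
    · subst h; linarith
    · simpa using hb j
  have ha's : ∑ j, a' j = 1 - c := by simp [ha', Finset.sum_sub_distrib, ha1]
  have hb's : ∑ j, b' j = 1 - c := by simp [hb', Finset.sum_sub_distrib, hb1]
  have hdiff : ∑ j, a j • u j - ∑ j, b j • u j = ∑ j, a' j • u j - ∑ j, b' j • u j := by
    simp [ha', hb', sub_smul, Finset.sum_sub_distrib]
  have h1c : 0 ≤ 1 - c := by rw [← ha's]; exact Finset.sum_nonneg fun j _ => ha'0 j
  rcases h1c.eq_or_lt with h0 | hpos
  · have hz : ∀ j, a' j = 0 := fun j =>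
      (Finset.sum_eq_zero_iff_of_nonneg (fun j _ => ha'0 j)).1 (ha's.trans h0.symm) j
        (Finset.mem_univ j)
    have hz' : ∀ j, b' j = 0 := fun j =>
      (Finset.sum_eq_zero_iff_of_nonneg (fun j _ => hb'0 j)).1 (hb's.trans h0.symm) j
        (Finset.mem_univ j)
    rw [hdiff, ← h0]
    simp [hz, hz']
  -- Both `a'` and `b'` have total mass `1 - c`, so the difference couples into a double sum.
  · have hmul : (1 - c) • (∑ j, a' j • u j - ∑ j, b' j • u j)
        = ∑ j, ∑ l, (a' j * b' l) • (u j - u l) := by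
      simp only [smul_sub, Finset.sum_sub_distrib]
      congr 1
      · rw [Finset.smul_sum]
        refine Finset.sum_congr rfl fun j _ => ?_
        rw [← Finset.sum_smul, ← Finset.mul_sum, hb's, smul_smul, mul_comm]
      · rw [Finset.sum_comm, Finset.smul_sum]
        refine Finset.sum_congr rfl fun l _ => ?_
        rw [← Finset.sum_smul, ← Finset.sum_mul, ha's, smul_smul]
    have hle : ‖(1 - c) • (∑ j, a' j • u j - ∑ j, b' j • u j)‖ ≤ (1 - c) * ((1 - c) * D) := by
      rw [hmul]
      calc _ ≤ ∑ j, ∑ l, a' j * b' l * D := by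
            refine norm_sum_le_of_le _ fun j _ => norm_sum_le_of_le _ fun l _ => ?_
            rw [norm_smul, Real.norm_of_nonneg (mul_nonneg (ha'0 j) (hb'0 l))]
            exact mul_le_mul_of_nonneg_left (hu j l) (mul_nonneg (ha'0 j) (hb'0 l))
        _ = _ := by
            simp only [← Finset.sum_mul, ← Finset.mul_sum, ha's, hb's]; ring
    rw [norm_smul, Real.norm_of_nonneg h1c] at hle
    rw [hdiff]
    exact le_of_mul_le_mul_left hle hpos

/-- Passing from `(w, v)` to `(M w, M v)` replaces the ratios by averages of them, with the weights
`M i j * w j / (M w) i`. -/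
lemma RatiosWithin.smul {n : ℕ} {V : Type*} [NormedAddCommGroup V] [NormedSpace ℝ V]
    {w : Fin n → ℝ} {v : Fin n → V} {D c : ℝ} {M : Matrix (Fin n) (Fin n) ℝ} {r : Fin n}
    (h : RatiosWithin w v D) (hM : ∀ i j, 0 ≤ M i j) (hw : ∀ i, 0 < w i)
    (hw' : ∀ i, 0 < (M • w) i) (hr : ∀ i, c ≤ M i r * w r / (M • w) i) :
    RatiosWithin (M • w) (M • v) ((1 - c) * D) := by
  have key : ∀ i, (1 / (M • w) i) • (M • v) i
      = ∑ j, (M i j * w j / (M • w) i) • ((1 / w j) • v j) := fun i => by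
    rw [Matrix.Module.smul_apply (v := v), Finset.smul_sum]
    refine Finset.sum_congr rfl fun j _ => ?_
    rw [smul_smul, smul_smul]
    congr 1
    have := (hw j).ne'
    field_simp
  have hsum : ∀ i, ∑ j, M i j * w j / (M • w) i = 1 := fun i => by
    rw [← Finset.sum_div]
    exact div_self (hw' i).ne'
  intro i k
  rw [key, key]
  exact norm_average_sub_average_le
    (fun j => div_nonneg (mul_nonneg (hM i j) (hw j).le) (hw' i).le)
    (fun j => div_nonneg (mul_nonneg (hM k j) (hw j).le) (hw' k).le)
    (hsum i) (hsum k) (hr i) (hr k) h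

lemma RatiosWithin.transition {n : ℕ} (hn : 2 ≤ n) {V : Type*} [NormedAddCommGroup V]
    [NormedSpace ℝ V] {G : ℕ → LoopDigraph n} {s : ℕ} {v : Fin n → V} {D : ℝ}
    (h : RatiosWithin (y G s) v D) (k : ℕ) :
    RatiosWithin (y G (s + k)) (transition G s k • v) D := by
  have h0 : ∀ i, 0 < (MSP.transition G s k • y G s) i := fun i => by
    rw [transition_smul_y]; exact y_pos G hn _ i
  have := RatiosWithin.smul (c := 0) (r := ⟨0, by omega⟩) h (transition_nonneg G s k)
    (y_pos G hn s) h0 fun i =>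
      div_nonneg (mul_nonneg (transition_nonneg G s k _ _) (y_nonneg G s _)) (h0 i).le
  rwa [transition_smul_y, sub_zero, one_mul] at this

/-- The nodes to which a value held by `r` has spread after `k` rounds over the graphs
`b 0, b 1, …`. -/
def reach {n : ℕ} (b : ℕ → LoopDigraph n) (r : Fin n) : ℕ → Set (Fin n)
  | 0 => {r}
  | k + 1 => {i | ∃ j ∈ reach b r k, (b k).1.Adj j i}

/-- A node that holds at least `1` at time `s` leaves at least `n^{-k}` at every node it has reached
`k ≤ 2 n` steps later; this is not below the threshold, so these nodes go on sending. -/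
lemma pow_le_transition_of_reach {n : ℕ} (hn : 2 ≤ n) {G : ℕ → LoopDigraph n} {s : ℕ}
    {b : ℕ → LoopDigraph n} {r : Fin n} (hr : 1 ≤ y G s r) {m : ℕ} (hm : m ≤ 2 * n)
    (hb : ∀ j < m, G (s + j) = b j) {k : ℕ} (hk : k ≤ m) {i : Fin n} (hi : i ∈ reach b r k) :
    (1 / (n : ℝ)) ^ k ≤ transition G s k i r := by
  have hn1 : (1 : ℝ) ≤ n := by exact_mod_cast (by omega : 1 ≤ n)
  induction k generalizing i with
  | zero =>
    rw [reach, Set.mem_singleton_iff] at hi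
    subst hi
    simp [transition]
  | succ k ih =>
    obtain ⟨j, hj, hji⟩ := hi
    have hjr := ih (by omega) hj
    -- As `k < m ≤ 2 n`, what `j` has received from `r` keeps it above `δ = n^{-2n}`.
    have hyj : delta n ≤ y G (s + k) j := by
      calc delta n = (1 / (n : ℝ)) ^ (2 * n) := by rw [delta, one_div_pow]
        _ ≤ (1 / (n : ℝ)) ^ k :=
          pow_le_pow_of_le_one (by positivity) (by rw [div_le_one (by positivity)]; exact hn1)
            (by omega)
        _ ≤ transition G s k j r := hjr
        _ ≤ transition G s k j r * y G s r := le_mul_of_one_le_right (transition_nonneg G s k j r) hr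
        _ ≤ y G (s + k) j := by
          rw [← transition_smul_y]
          exact Finset.single_le_sum (f := fun l => transition G s k j l * y G s l)
            (fun l _ => mul_nonneg (transition_nonneg G s k j l) (y_nonneg G s l))
            (Finset.mem_univ r)
    have hadj : (effectiveGraph (G (s + k)) (y G (s + k))).Adj j i := by
      refine ⟨?_, Or.inr hyj⟩
      rw [hb k (by omega)]
      exact hji
    calc (1 / (n : ℝ)) ^ (k + 1) = 1 / n * (1 / (n : ℝ)) ^ k := pow_succ' _ _
      _ ≤ stepMatrix G (s + k) i j * transition G s k j r :=
        mul_le_mul (one_div_le_weight hadj) hjr (by positivity) (stepMatrix_nonneg G _ i j)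
      _ ≤ transition G s (k + 1) i r := by
        rw [transition, Matrix.mul_apply]
        exact Finset.single_le_sum
          (f := fun l => stepMatrix G (s + k) i l * transition G s k l r)
          (fun l _ => mul_nonneg (stepMatrix_nonneg G _ i l) (transition_nonneg G s k l r))
          (Finset.mem_univ j)

lemma RatiosWithin.window {n : ℕ} (hn : 2 ≤ n) {V : Type*} [NormedAddCommGroup V]
    [NormedSpace ℝ V] {G : ℕ → LoopDigraph n} {s : ℕ} {b : ℕ → LoopDigraph n} {r : Fin n}
    (hr : 1 ≤ y G s r) (hb : ∀ j < n - 1, G (s + j) = b j)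
    (hreach : reach b r (n - 1) = Set.univ) {v : Fin n → V} {D : ℝ}
    (h : RatiosWithin (y G s) v D) :
    RatiosWithin (y G (s + (n - 1))) (MSP.transition G s (n - 1) • v)
      ((1 - 1 / (n : ℝ) ^ n) * D) := by
  have hn0 : (0 : ℝ) < n := by exact_mod_cast (by omega : 0 < n)
  have h0 : ∀ i, 0 < (MSP.transition G s (n - 1) • y G s) i := fun i => by
    rw [transition_smul_y]; exact y_pos G hn _ i
  have := RatiosWithin.smul (c := 1 / (n : ℝ) ^ n) (r := r) h (transition_nonneg G s (n - 1))
    (y_pos G hn s) h0 fun i => by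
      have h1 := pow_le_transition_of_reach hn hr (by omega) hb le_rfl (hreach ▸ Set.mem_univ i)
      have h2 : (MSP.transition G s (n - 1) • y G s) i ≤ n := by
        rw [transition_smul_y]; exact y_le G _ i
      rw [le_div_iff₀ (h0 i)]
      calc 1 / (n : ℝ) ^ n * (MSP.transition G s (n - 1) • y G s) i ≤ 1 / (n : ℝ) ^ n * n :=
            mul_le_mul_of_nonneg_left h2 (by positivity)
        _ = (1 / (n : ℝ)) ^ (n - 1) := by
            obtain ⟨m, rfl⟩ : ∃ m, n = m + 1 := ⟨n - 1, by omega⟩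
            rw [Nat.add_sub_cancel, pow_succ, one_div_pow]
            field_simp
        _ ≤ MSP.transition G s (n - 1) i r := h1
        _ ≤ MSP.transition G s (n - 1) i r * y G s r :=
            le_mul_of_one_le_right (transition_nonneg G s _ i r) hr
  rwa [transition_smul_y] at this

/-! ### Graph sequences that spread the value of a node everywhere -/

lemma StronglyConnected.exists_adj_of_ne_univ {n : ℕ} {H : Digraph (Fin n)}
    (hH : StronglyConnected H) {R : Set (Fin n)} (hR : R.Nonempty) (hR' : R ≠ Set.univ) :
    ∃ j ∈ R, ∃ i, i ∉ R ∧ H.Adj j i := by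
  by_contra! hcon
  obtain ⟨u, hu⟩ := hR
  refine hR' (Set.eq_univ_of_forall fun v => ?_)
  induction hH u v with
  | refl => exact hu
  | tail _ hbc ih => exact by_contra fun hc => hcon _ ih _ hc hbc

/-- Every set of nodes that is not yet everything is left by an edge of some graph of positive
probability; using such a graph at each step reaches all nodes in `n - 1` steps. -/
lemma exists_reach_eq_univ {n : ℕ} (hn : 2 ≤ n) {p : LoopDigraph n → ℝ}
    (hp : StronglyConnected (unionGraph p)) (r : Fin n) :
    ∃ b : ℕ → LoopDigraph n, (∀ k, 0 < p (b k)) ∧ reach b r (n - 1) = Set.univ := by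
  obtain ⟨H₀, hH₀⟩ : ∃ H, 0 < p H := by
    have : ({(⟨0, by omega⟩ : Fin n)} : Set (Fin n)) ≠ Set.univ := fun h => by
      have h1 : (⟨1, by omega⟩ : Fin n) ∈ ({(⟨0, by omega⟩ : Fin n)} : Set (Fin n)) :=
        h ▸ Set.mem_univ _
      simp at h1
    obtain ⟨_, _, _, _, H, hH, _⟩ := hp.exists_adj_of_ne_univ (Set.singleton_nonempty _) this
    exact ⟨H, hH⟩
  have hstep : ∀ R : Set (Fin n), ∃ H : LoopDigraph n, 0 < p H ∧
      (R.Nonempty → R ≠ Set.univ → ∃ j ∈ R, ∃ i, i ∉ R ∧ H.1.Adj j i) := fun R => by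
    by_cases h : R.Nonempty ∧ R ≠ Set.univ
    · obtain ⟨j, hj, i, hi, H, hH, hji⟩ := hp.exists_adj_of_ne_univ h.1 h.2
      exact ⟨H, hH, fun _ _ => ⟨j, hj, i, hi, hji⟩⟩
    · exact ⟨H₀, hH₀, fun h1 h2 => absurd ⟨h1, h2⟩ h⟩
  choose H hHp hH using hstep
  -- `R k` is the set reached after `k` steps when each graph is chosen according to the set
  -- reached so far; it grows by at least one node per step until it is everything.
  let R : ℕ → Set (Fin n) := fun k => k.rec {r} fun _ R => {i | ∃ j ∈ R, (H R).1.Adj j i}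
  have hreach : ∀ k, reach (fun k => H (R k)) r k = R k := fun k => by
    induction k with
    | zero => rfl
    | succ k ih => rw [reach, ih]
  have hsub : ∀ k, R k ⊆ R (k + 1) := fun k i hi => ⟨i, hi, (H (R k)).2 i⟩
  have hmem : ∀ k, r ∈ R k := fun k => by
    induction k with
    | zero => exact rfl
    | succ k ih => exact hsub k ih
  have hcard : ∀ k, k + 1 ≤ n → k + 1 ≤ (R k).ncard := fun k => by
    induction k with
    | zero => intro _; simp [R]
    | succ k ih =>
      intro hk
      have h1 := ih (by omega)
      by_cases hu : R k = Set.univ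
      · have h2 : R (k + 1) = Set.univ := Set.univ_subset_iff.1 (hu ▸ hsub k)
        rw [h2, Set.ncard_univ, Nat.card_eq_fintype_card, Fintype.card_fin]
        exact hk
      · obtain ⟨j, hj, i, hi, hji⟩ := hH (R k) ⟨r, hmem k⟩ hu
        exact h1.trans_lt (Set.ncard_lt_ncard
          (LE.le.ssubset_of_mem_notMem (hsub k) ⟨j, hj, hji⟩ hi) (Set.toFinite _))
  refine ⟨fun k => H (R k), fun k => hHp _, ?_⟩
  rw [hreach]
  refine Set.eq_of_subset_of_ncard_le (Set.subset_univ _) ?_ (Set.toFinite _)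
  rw [Set.ncard_univ, Nat.card_eq_fintype_card, Fintype.card_fin]
  have := hcard (n - 1) (by omega)
  omega

/-! ### The random contraction factor -/

lemma y_congr {n : ℕ} {G G' : ℕ → LoopDigraph n} {t : ℕ} (h : ∀ s < t, G s = G' s) :
    y G t = y G' t := by
  induction t with
  | zero => rfl
  | succ t ih => rw [y, y, ih fun s hs => h s (by omega), h t (by omega)]

lemma stepMatrix_congr {n : ℕ} {G G' : ℕ → LoopDigraph n} {t : ℕ} (h : ∀ s < t + 1, G s = G' s) :
    stepMatrix G t = stepMatrix G' t := by
  rw [stepMatrix, stepMatrix, y_congr fun s hs => h s (by omega), h t (by omega)]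

/-- A node at which `v` is at least `1`, if there is one. -/
noncomputable def heavyNode {n : ℕ} [Nonempty (Fin n)] (v : Fin n → ℝ) : Fin n :=
  Classical.epsilon fun r => 1 ≤ v r

lemma one_le_y_heavyNode {n : ℕ} [Nonempty (Fin n)] (hn : 2 ≤ n) (G : ℕ → LoopDigraph n) (t : ℕ) :
    1 ≤ y G t (heavyNode (y G t)) :=
  Classical.epsilon_spec (exists_one_le_y G hn t)

/-- During the `n - 1` steps from time `t` on, the graphs are the ones which `b` prescribes for
spreading the value of the heavy node of time `t`. -/
def GoodWindow {n : ℕ} [Nonempty (Fin n)] (b : Fin n → ℕ → LoopDigraph n)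
    (G : ℕ → LoopDigraph n) (t : ℕ) : Prop :=
  ∀ j < n - 1, G (t + j) = b (heavyNode (y G t)) j

open Classical in
/-- The factor by which the ratios certainly contract in the `K` windows of length `n - 1` that
follow time `s`: each good window contributes `1 - n^{-n}`. -/
noncomputable def factor {n : ℕ} [Nonempty (Fin n)] (b : Fin n → ℕ → LoopDigraph n)
    (G : ℕ → LoopDigraph n) (s : ℕ) : ℕ → ℝ
  | 0 => 1
  | K + 1 => factor b G s K *
      if GoodWindow b G (s + K * (n - 1)) then 1 - 1 / (n : ℝ) ^ n else 1

lemma one_div_pow_le_one (n : ℕ) : 1 / (n : ℝ) ^ n ≤ 1 := by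
  rcases n.eq_zero_or_pos with rfl | h
  · simp
  · have : (1 : ℝ) ≤ n := by exact_mod_cast h
    rw [div_le_one (by positivity)]
    exact one_le_pow₀ this

section Factor

variable {n : ℕ} [Nonempty (Fin n)] (b : Fin n → ℕ → LoopDigraph n)

lemma factor_nonneg (G : ℕ → LoopDigraph n) (s K : ℕ) : 0 ≤ factor b G s K := by
  induction K with
  | zero => simp [factor]
  | succ K ih =>
    have := one_div_pow_le_one n
    rw [factor]
    refine mul_nonneg ih ?_
    split_ifs <;> linarith

lemma factor_le_one (G : ℕ → LoopDigraph n) (s K : ℕ) : factor b G s K ≤ 1 := by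
  induction K with
  | zero => simp [factor]
  | succ K ih =>
    have := one_div_pow_le_one n
    have : 0 ≤ 1 / (n : ℝ) ^ n := by positivity
    rw [factor]
    refine mul_le_one₀ ih ?_ ?_ <;> split_ifs <;> linarith

lemma goodWindow_congr {G G' : ℕ → LoopDigraph n} {t : ℕ}
    (h : ∀ s < t + (n - 1), G s = G' s) : GoodWindow b G t ↔ GoodWindow b G' t := by
  unfold GoodWindow
  rw [y_congr fun s hs => h s (by omega)]
  exact forall₂_congr fun j hj => by rw [h _ (by omega)]

lemma factor_congr {G G' : ℕ → LoopDigraph n} {s K : ℕ}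
    (h : ∀ t < s + K * (n - 1), G t = G' t) : factor b G s K = factor b G' s K := by
  induction K with
  | zero => rfl
  | succ K ih =>
    rw [Nat.succ_mul, ← add_assoc] at h
    rw [factor, factor, ih fun t ht => h t (by omega)]
    have hiff := goodWindow_congr b h
    by_cases hg : GoodWindow b G (s + K * (n - 1))
    · rw [if_pos hg, if_pos (hiff.1 hg)]
    · rw [if_neg hg, if_neg fun hg' => hg (hiff.2 hg')]

variable {b}

lemma RatiosWithin.factor (hn : 2 ≤ n) {V : Type*} [NormedAddCommGroup V] [NormedSpace ℝ V]
    (hreach : ∀ r, reach (b r) r (n - 1) = Set.univ) {G : ℕ → LoopDigraph n} {s : ℕ}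
    {v : Fin n → V} {D : ℝ} (h : RatiosWithin (y G s) v D) (k : ℕ) :
    RatiosWithin (y G (s + k)) (MSP.transition G s k • v)
      (MSP.factor b G s (k / (n - 1)) * D) := by
  have key : ∀ K, RatiosWithin (y G (s + K * (n - 1))) (MSP.transition G s (K * (n - 1)) • v)
      (MSP.factor b G s K * D) := fun K => by
    induction K with
    | zero => simpa [MSP.factor, MSP.transition] using h
    | succ K ih =>
      rw [Nat.succ_mul, ← add_assoc, transition_add, mul_smul, MSP.factor]
      split_ifs with hgood
      · rw [mul_comm (MSP.factor b G s K), mul_assoc]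
        exact ih.window hn (one_le_y_heavyNode hn G _) hgood (hreach _)
      · rw [mul_one]
        exact ih.transition hn _
  have hk : k = k / (n - 1) * (n - 1) + k % (n - 1) := (Nat.div_add_mod' _ _).symm
  have := (key (k / (n - 1))).transition hn (k % (n - 1))
  rwa [← mul_smul, ← transition_add, add_assoc, ← hk] at this

end Factor

/-! ### The expected contraction factor -/

instance (n : ℕ) : DiscreteMeasurableSpace (LoopDigraph n) := ⟨fun _ => trivial⟩

instance (n : ℕ) : Finite (LoopDigraph n) :=
  inferInstanceAs (Finite {G : Digraph (Fin n) // ∀ v, G.Adj v v})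

instance (n : ℕ) : Nonempty (LoopDigraph n) := ⟨⟨⊤, fun _ => trivial⟩⟩

section Expectation

variable {n : ℕ} {Ω : Type*} [MeasurableSpace Ω] {μ : Measure Ω}
  {G : ℕ → Ω → LoopDigraph n} {p : LoopDigraph n → ℝ}

/-- A function of finitely many of the graphs is a function on a finite discrete space. -/
lemma exists_eq_comp_restrict {α : Type*} {Φ : (ℕ → LoopDigraph n) → α} {t : ℕ}
    (hΦ : ∀ ⦃G G' : ℕ → LoopDigraph n⦄, (∀ s < t, G s = G' s) → Φ G = Φ G') :
    ∃ φ : (Finset.range t → LoopDigraph n) → α, ∀ G, Φ G = φ fun s => G s := by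
  obtain ⟨H₀⟩ : Nonempty (LoopDigraph n) := inferInstance
  refine ⟨fun h => Φ fun s => if hs : s ∈ Finset.range t then h ⟨s, hs⟩ else H₀,
    fun G => hΦ fun s hs => ?_⟩
  rw [dif_pos (Finset.mem_range.2 hs)]

lemma measurable_of_congr {α : Type*} [MeasurableSpace α] (hG : ∀ t, Measurable (G t))
    {Φ : (ℕ → LoopDigraph n) → α} {t : ℕ}
    (hΦ : ∀ ⦃G G' : ℕ → LoopDigraph n⦄, (∀ s < t, G s = G' s) → Φ G = Φ G') :
    Measurable fun ω => Φ fun s => G s ω := by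
  obtain ⟨φ, hφ⟩ := exists_eq_comp_restrict hΦ
  simp only [hφ]
  exact (Measurable.of_discrete (f := φ)).comp (measurable_pi_lambda _ fun s => hG s)

open Classical in
/-- What happened before time `t` is independent of which graphs follow. -/
lemma integral_mul_indicator (hG : RandomGraphAssumption μ G p) {Φ : (ℕ → LoopDigraph n) → ℝ}
    {t : ℕ} (hΦ : ∀ ⦃G G' : ℕ → LoopDigraph n⦄, (∀ s < t, G s = G' s) → Φ G = Φ G')
    (c : ℕ → LoopDigraph n) (m : ℕ) :
    ∫ ω, Φ (fun s => G s ω) * (if ∀ j < m, G (t + j) ω = c j then 1 else 0) ∂μ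
      = (∫ ω, Φ (fun s => G s ω) ∂μ) * ∏ j ∈ Finset.range m, p (c j) := by
  obtain ⟨φ, hφ⟩ := exists_eq_comp_restrict hΦ
  let ψ : (Finset.Ico t (t + m) → LoopDigraph n) → ℝ := fun h =>
    if ∀ j, ∀ hj : j < m, h ⟨t + j, by rw [Finset.mem_Ico]; omega⟩ = c j then 1 else 0
  have hdisj : Disjoint (Finset.range t) (Finset.Ico t (t + m)) := by
    rw [Finset.disjoint_left]
    intro a ha ha'
    rw [Finset.mem_range] at ha
    rw [Finset.mem_Ico] at ha'
    omega
  have hind := hG.indep.indepFun_finset _ _ hdisj hG.measurable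
  have hmul := hind.integral_fun_comp_mul_comp (𝕜 := ℝ) (f := φ) (g := ψ)
    (measurable_pi_lambda _ fun s : Finset.range t => hG.measurable s).aemeasurable
    (measurable_pi_lambda _ fun s : Finset.Ico t (t + m) => hG.measurable s).aemeasurable
    Measurable.of_discrete.aestronglyMeasurable Measurable.of_discrete.aestronglyMeasurable
  have hprob : ∫ ω, (if ∀ j < m, G (t + j) ω = c j then (1 : ℝ) else 0) ∂μ
      = ∏ j ∈ Finset.range m, p (c j) := by
    have hset : {ω | ∀ j < m, G (t + j) ω = c j}
        = ⋂ j ∈ Finset.range m, G (t + j) ⁻¹' {c j} := by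
      ext ω; simp
    have hmeas : MeasurableSet {ω | ∀ j < m, G (t + j) ω = c j} := by
      rw [hset]
      exact Finset.measurableSet_biInter _ fun j _ => hG.measurable _ trivial
    have hindic : (fun ω => if ∀ j < m, G (t + j) ω = c j then (1 : ℝ) else 0)
        = Set.indicator {ω | ∀ j < m, G (t + j) ω = c j} 1 := by
      ext ω; simp [Set.indicator_apply]
    have hinj : Function.Injective fun j => t + j := fun a b h => by simpa using h
    rw [hindic, integral_indicator_one hmeas, hset, measureReal_def,
      (hG.indep.precomp hinj).measure_inter_preimage_eq_mul (Finset.range m) (sets := fun j => {c j})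
        (fun j _ => trivial), ENNReal.toReal_prod]
    exact Finset.prod_congr rfl fun j _ => hG.prob (t + j) (c j)
  simp only [hφ]
  rw [← hprob]
  exact hmul

lemma integrable_of_congr [IsProbabilityMeasure μ] (hG : RandomGraphAssumption μ G p)
    {Φ : (ℕ → LoopDigraph n) → ℝ} {t : ℕ}
    (hΦ : ∀ ⦃G G' : ℕ → LoopDigraph n⦄, (∀ s < t, G s = G' s) → Φ G = Φ G')
    {C : ℝ} (hC : ∀ G, |Φ G| ≤ C) : Integrable (fun ω => Φ fun s => G s ω) μ :=
  Integrable.of_bound (measurable_of_congr hG.measurable hΦ).aestronglyMeasurable C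
    (Filter.Eventually.of_forall fun _ => hC _)

variable [Nonempty (Fin n)]

lemma integrable_factor [IsProbabilityMeasure μ] (hG : RandomGraphAssumption μ G p)
    (b : Fin n → ℕ → LoopDigraph n) (s K : ℕ) :
    Integrable (fun ω => factor b (fun t => G t ω) s K) μ :=
  integrable_of_congr hG (Φ := fun G => factor b G s K) (fun _ _ h => factor_congr b h) (C := 1)
    fun G => by rw [abs_of_nonneg (factor_nonneg b G s K)]; exact factor_le_one b G s K

/-- Given the past, the next window is good with probability at least `π ^ (n - 1)`, whichever node
is heavy. -/
lemma integral_factor_le [IsProbabilityMeasure μ] (hG : RandomGraphAssumption μ G p)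
    {b : Fin n → ℕ → LoopDigraph n} {π : ℝ} (hπ : 0 ≤ π) (hb : ∀ r k, π ≤ p (b r k))
    (s K : ℕ) :
    ∫ ω, factor b (fun t => G t ω) s K ∂μ ≤ (1 - π ^ (n - 1) / (n : ℝ) ^ n) ^ K := by
  classical
  have hn1 := one_div_pow_le_one n
  have hn0 : 0 ≤ 1 / (n : ℝ) ^ n := by positivity
  have hπ1 : π ≤ 1 := by
    obtain ⟨r⟩ : Nonempty (Fin n) := inferInstance
    refine (hb r 0).trans ?_
    rw [← hG.prob 0]
    exact measureReal_le_one
  have hq : 0 ≤ 1 - π ^ (n - 1) / (n : ℝ) ^ n := by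
    have h1 : π ^ (n - 1) * (1 / (n : ℝ) ^ n) ≤ 1 := mul_le_one₀ (pow_le_one₀ hπ hπ1) hn0 hn1
    rw [mul_one_div] at h1
    linarith
  induction K with
  | zero => simp [factor]
  | succ K ih =>
    set T := s + K * (n - 1) with hT
    -- Split according to the heavy node `r` at the start `T` of the window: `A r` depends on the
    -- graphs before `T` only, and on `A r ≠ 0` the prescribed graphs are the fixed `b r`.
    set A : Fin n → (ℕ → LoopDigraph n) → ℝ := fun r G =>
      factor b G s K * if heavyNode (y G T) = r then 1 else 0 with hA
    have hAcongr : ∀ r, ∀ ⦃G G' : ℕ → LoopDigraph n⦄, (∀ t < T, G t = G' t) → A r G = A r G' :=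
      fun r G G' h => by simp only [hA]; rw [factor_congr b h, y_congr h]
    have hA0 : ∀ r G, 0 ≤ A r G := fun r G => by
      simp only [hA]; split_ifs <;> simp [factor_nonneg]
    have hA1 : ∀ r G, A r G ≤ 1 := fun r G => by
      simp only [hA]; split_ifs <;> simp [factor_le_one]
    have hAint : ∀ r, Integrable (fun ω => A r fun t => G t ω) μ := fun r =>
      integrable_of_congr hG (hAcongr r) (C := 1) fun G => by
        rw [abs_of_nonneg (hA0 r G)]; exact hA1 r G
    have hAsum : ∀ G, ∑ r, A r G = factor b G s K := fun G => by
      simp [hA]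
    have hAWint : ∀ r, Integrable (fun ω => A r (fun t => G t ω) *
        (if ∀ j < n - 1, G (T + j) ω = b r j then (1 : ℝ) else 0)) μ := fun r =>
      integrable_of_congr hG (Φ := fun G => A r G *
          (if ∀ j < n - 1, G (T + j) = b r j then (1 : ℝ) else 0)) (t := T + (n - 1)) (C := 1)
        (fun G G' h => by
          have h1 := hAcongr r (G := G) (G' := G') fun t ht => h t (by omega)
          have h2 : (∀ j < n - 1, G (T + j) = b r j) ↔ ∀ j < n - 1, G' (T + j) = b r j :=
            forall₂_congr fun j hj => by rw [h _ (by omega)]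
          simp only [h1, h2])
        fun G => by
          rw [abs_of_nonneg (mul_nonneg (hA0 r G) (by split_ifs <;> norm_num))]
          exact mul_le_one₀ (hA1 r G) (by split_ifs <;> norm_num) (by split_ifs <;> norm_num)
    have hstep : ∀ G, factor b G s (K + 1) = factor b G s K - 1 / (n : ℝ) ^ n *
        ∑ r, A r G * (if ∀ j < n - 1, G (T + j) = b r j then (1 : ℝ) else 0) := fun G => by
      have h1 : ∑ r, A r G * (if ∀ j < n - 1, G (T + j) = b r j then (1 : ℝ) else 0)
          = factor b G s K * if GoodWindow b G T then 1 else 0 := by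
        rw [Finset.sum_eq_single (heavyNode (y G T))]
        · simp only [hA, if_true, mul_one]; congr
        · intro r _ hr
          simp [hA, hr.symm]
        · simp
      rw [h1, factor]
      split_ifs <;> ring
    have hW : ∀ r, (∫ ω, A r (fun t => G t ω) ∂μ) * π ^ (n - 1) ≤ ∫ ω, A r (fun t => G t ω) *
        (if ∀ j < n - 1, G (T + j) ω = b r j then (1 : ℝ) else 0) ∂μ := fun r => by
      rw [integral_mul_indicator hG (hAcongr r) (b r) (n - 1)]
      refine mul_le_mul_of_nonneg_left ?_ (integral_nonneg fun ω => hA0 r _)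
      calc π ^ (n - 1) = ∏ j ∈ Finset.range (n - 1), π := by simp
        _ ≤ _ := Finset.prod_le_prod (fun _ _ => hπ) fun j _ => hb r j
    have hfac : ∫ ω, factor b (fun t => G t ω) s K ∂μ = ∑ r, ∫ ω, A r (fun t => G t ω) ∂μ := by
      rw [← integral_finsetSum _ fun r _ => hAint r]
      simp only [hAsum]
    calc ∫ ω, factor b (fun t => G t ω) s (K + 1) ∂μ
        = ∫ ω, factor b (fun t => G t ω) s K ∂μ - 1 / (n : ℝ) ^ n *
          ∑ r, ∫ ω, A r (fun t => G t ω) *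
            (if ∀ j < n - 1, G (T + j) ω = b r j then (1 : ℝ) else 0) ∂μ := by
          simp only [hstep]
          rw [integral_sub (integrable_factor hG b s K)
            ((integrable_finsetSum _ fun r _ => hAWint r).const_mul _), integral_const_mul,
            integral_finsetSum _ fun r _ => hAWint r]
      _ ≤ ∫ ω, factor b (fun t => G t ω) s K ∂μ - 1 / (n : ℝ) ^ n *
          ∑ r, (∫ ω, A r (fun t => G t ω) ∂μ) * π ^ (n - 1) :=
        sub_le_sub_left (mul_le_mul_of_nonneg_left (Finset.sum_le_sum fun r _ => hW r) hn0) _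
      _ = (∫ ω, factor b (fun t => G t ω) s K ∂μ) * (1 - π ^ (n - 1) / (n : ℝ) ^ n) := by
        rw [← Finset.sum_mul, ← hfac]; ring
      _ ≤ (1 - π ^ (n - 1) / (n : ℝ) ^ n) ^ K * (1 - π ^ (n - 1) / (n : ℝ) ^ n) :=
        mul_le_mul_of_nonneg_right ih hq
      _ = _ := (pow_succ _ _).symm

end Expectation

/-! ### Step sizes -/

lemma alpha_nonneg (γ : ℝ) (t : ℕ) : 0 ≤ alpha γ t := by unfold alpha; positivity

lemma alpha_succ_pos (γ : ℝ) (t : ℕ) : 0 < alpha γ (t + 1) := by unfold alpha; positivity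

lemma alpha_succ_anti {γ : ℝ} (hγ : 0 ≤ γ) {s t : ℕ} (h : s ≤ t) :
    alpha γ (t + 1) ≤ alpha γ (s + 1) := by
  unfold alpha
  exact one_div_le_one_div_of_le (by positivity)
    (Real.rpow_le_rpow (by positivity) (by exact_mod_cast Nat.succ_le_succ h) hγ)

lemma alpha_succ_le_one {γ : ℝ} (hγ : 0 ≤ γ) (t : ℕ) : alpha γ (t + 1) ≤ 1 := by
  simpa [alpha] using alpha_succ_anti hγ (Nat.zero_le t)

/-- A discrete form of `(x ^ a)' = a * x ^ (a - 1)` for `0 ≤ a ≤ 1`. -/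
lemma rpow_add_one_sub_rpow_le {a : ℝ} (ha : 0 ≤ a) (ha1 : a ≤ 1) {x : ℝ} (hx : 0 < x) :
    (x + 1) ^ a - x ^ a ≤ a * x ^ (a - 1) := by
  have h1 := rpow_one_add_le_one_add_mul_self (s := 1 / x) (p := a)
    (by have : 0 < 1 / x := by positivity
        linarith) ha ha1
  have h2 : (x + 1) ^ a = x ^ a * (1 + 1 / x) ^ a := by
    rw [← Real.mul_rpow hx.le (by positivity)]
    congr 1
    field_simp
  have h3 : x ^ (a - 1) = x ^ a * (1 / x) := by
    rw [Real.rpow_sub_one hx.ne', mul_one_div]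
  have h4 : 0 ≤ x ^ a := by positivity
  rw [h2, h3]
  nlinarith [mul_le_mul_of_nonneg_left h1 h4]

lemma le_mul_sum_alpha {γ : ℝ} (hγ : 0 ≤ γ) (hγ' : γ < 1) (t : ℕ) :
    ((t : ℝ) + 1) ^ (1 - γ) - 1 ≤ (1 - γ) * S γ t := by
  induction t with
  | zero => simp [S]
  | succ t ih =>
    have h := rpow_add_one_sub_rpow_le (a := 1 - γ) (by linarith) (by linarith)
      (x := (t : ℝ) + 1) (by positivity)
    have h2 : ((t : ℝ) + 1) ^ (1 - γ - 1) = alpha γ (t + 1) := by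
      rw [show 1 - γ - 1 = -γ by ring, Real.rpow_neg (by positivity), alpha, one_div]
      push_cast; rfl
    rw [h2] at h
    rw [S, Finset.sum_range_succ, mul_add, ← S]
    push_cast
    linarith

lemma sum_alpha_sq_le {γ : ℝ} (hγ : 1 / 2 < γ) (hγ' : γ < 1) (t : ℕ) :
    ∑ s ∈ Finset.range t, alpha γ (s + 1) ^ 2 ≤ 1 + 1 / (2 * γ - 1) := by
  set b := 2 * γ - 1 with hb
  have hb0 : 0 < b := by linarith
  have hb1 : b ≤ 1 := by linarith
  -- The telescoping bound comes from `∫ x ^ (-(b + 1)) = -x ^ (-b) / b`.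
  have key : ∀ t : ℕ, ∑ s ∈ Finset.range (t + 1), alpha γ (s + 1) ^ 2
      ≤ 1 + 1 / b - 1 / b * ((t : ℝ) + 1) ^ (-b) := fun t => by
    induction t with
    | zero => simp [alpha]
    | succ t ih =>
      rw [Finset.sum_range_succ]
      set x : ℝ := (t : ℝ) + 1 with hx
      have hx0 : 0 < x := by positivity
      have h1 : alpha γ (t + 1 + 1) ^ 2 = (x + 1) ^ (-b) * (1 / (x + 1)) := by
        rw [mul_one_div, ← Real.rpow_sub_one (by positivity), show -b - 1 = -(γ * 2) by rw [hb]; ring,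
          Real.rpow_neg (by positivity), Real.rpow_mul (by positivity), alpha, hx]
        push_cast
        norm_num
      have h2 := rpow_one_add_le_one_add_mul_self (s := -(1 / (x + 1))) (p := b)
        (by rw [neg_le_neg_iff, div_le_one (by positivity)]; linarith) hb0.le hb1
      have h3 : (1 : ℝ) + -(1 / (x + 1)) = x / (x + 1) := by field_simp; ring
      rw [h3, Real.div_rpow hx0.le (by positivity), div_le_iff₀ (by positivity)] at h2
      have h4 : (x + 1) ^ (-b) * (1 + b * (1 / (x + 1))) ≤ x ^ (-b) := by
        set u := 1 / (x + 1) with hu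
        have hu0 : 0 ≤ u := by positivity
        rw [Real.rpow_neg (by positivity), Real.rpow_neg hx0.le, inv_mul_le_iff₀ (by positivity),
          ← div_eq_mul_inv, le_div_iff₀ (by positivity)]
        have hp : 0 ≤ (x + 1) ^ b := by positivity
        calc (1 + b * u) * x ^ b ≤ (1 + b * u) * ((1 + b * -u) * (x + 1) ^ b) :=
              mul_le_mul_of_nonneg_left h2 (by positivity)
          _ = (1 - (b * u) ^ 2) * (x + 1) ^ b := by ring
          _ ≤ (x + 1) ^ b := mul_le_of_le_one_left hp (by nlinarith [sq_nonneg (b * u)])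
      have h5 : 1 / b * ((x + 1) ^ (-b) * (1 + b * (1 / (x + 1))))
          = 1 / b * (x + 1) ^ (-b) + (x + 1) ^ (-b) * (1 / (x + 1)) := by
        field_simp
      have h6 := mul_le_mul_of_nonneg_left h4 (by positivity : 0 ≤ 1 / b)
      rw [h5] at h6
      rw [h1]
      push_cast
      linarith
  cases t with
  | zero => simp; positivity
  | succ t =>
    have : 0 ≤ 1 / b * ((t : ℝ) + 1) ^ (-b) := by positivity
    linarith [key t]

lemma S_succ_pos (γ : ℝ) (t : ℕ) : 0 < S γ (t + 1) :=
  Finset.sum_pos (fun s _ => alpha_succ_pos γ s) (by simp)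

lemma Gam_nonneg {γ : ℝ} (hγ' : γ < 1) (t : ℕ) : 0 ≤ Gam γ t := by
  refine div_nonneg (by linarith) ?_
  have : (1 : ℝ) ≤ ((t : ℝ) + 2) ^ (1 - γ) :=
    Real.one_le_rpow (by linarith [(Nat.cast_nonneg t : (0 : ℝ) ≤ t)]) (by linarith)
  linarith

lemma one_div_S_le_Gam {γ : ℝ} (hγ : 0 ≤ γ) (hγ' : γ < 1) (t : ℕ) :
    1 / S γ (t + 1) ≤ Gam γ t := by
  have h := le_mul_sum_alpha hγ hγ' (t + 1)
  push_cast at h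
  rw [show (t : ℝ) + 1 + 1 = t + 2 by ring] at h
  have hpos : (1 : ℝ) < ((t : ℝ) + 2) ^ (1 - γ) :=
    Real.one_lt_rpow (by linarith [(Nat.cast_nonneg t : (0 : ℝ) ≤ t)]) (by linarith)
  rw [Gam, div_le_div_iff₀ (S_succ_pos γ t) (by linarith)]
  linarith

lemma Gam_isBigO {γ : ℝ} (hγ' : γ < 1) :
    (fun t => Gam γ t) =O[Filter.atTop] fun t : ℕ => (t : ℝ) ^ (-(1 - γ)) := by
  set a := 1 - γ with ha
  have ha0 : 0 < a := by linarith
  have h3 : (1 : ℝ) < 3 ^ a := Real.one_lt_rpow (by norm_num) ha0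
  have hc : 0 < 1 - 1 / (3 : ℝ) ^ a := by
    rw [sub_pos, div_lt_one (by positivity)]; exact h3
  refine Asymptotics.IsBigO.of_bound (a / (1 - 1 / (3 : ℝ) ^ a)) ?_
  filter_upwards [Filter.eventually_ge_atTop 1] with t ht
  have ht1 : (1 : ℝ) ≤ t := by exact_mod_cast ht
  have hge : (1 - 1 / (3 : ℝ) ^ a) * (t : ℝ) ^ a ≤ ((t : ℝ) + 2) ^ a - 1 := by
    have h4 : (1 : ℝ) ≤ ((t : ℝ) + 2) ^ a * (1 / 3 ^ a) := by
      rw [mul_one_div, ← Real.div_rpow (by positivity) (by norm_num)]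
      exact Real.one_le_rpow (by linarith) ha0.le
    have h5 : (t : ℝ) ^ a ≤ ((t : ℝ) + 2) ^ a :=
      Real.rpow_le_rpow (by positivity) (by linarith) ha0.le
    nlinarith [mul_le_mul_of_nonneg_left h5 hc.le]
  rw [Real.norm_of_nonneg (Gam_nonneg hγ' t), Real.norm_of_nonneg (by positivity),
    Real.rpow_neg (by positivity), ← div_eq_mul_inv, div_div, Gam, ← ha]
  exact div_le_div_of_nonneg_left ha0.le (by positivity) hge

/-! ### Sums of the contraction rate -/

lemma sum_pow_div_le {q : ℝ} (hq : 0 ≤ q) (hq1 : q < 1) {m : ℕ} (hm : 0 < m) (N : ℕ) :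
    ∑ k ∈ Finset.range N, q ^ (k / m) ≤ m / (1 - q) := by
  have hblock : ∀ K : ℕ, ∑ k ∈ Finset.range (K * m), q ^ (k / m)
      = m * ∑ l ∈ Finset.range K, q ^ l := fun K => by
    induction K with
    | zero => simp
    | succ K ih =>
      rw [Nat.succ_mul, Finset.sum_range_add, ih, Finset.sum_range_succ, mul_add]
      congr 1
      rw [Finset.sum_congr rfl (g := fun _ => q ^ K) fun j hj => ?_]
      · simp
      · rw [mul_comm K, Nat.mul_add_div hm, Nat.div_eq_of_lt (Finset.mem_range.1 hj), add_zero]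
  calc ∑ k ∈ Finset.range N, q ^ (k / m) ≤ ∑ k ∈ Finset.range (N * m), q ^ (k / m) :=
        Finset.sum_le_sum_of_subset_of_nonneg
          (Finset.range_subset_range.2 (Nat.le_mul_of_pos_right N hm)) fun _ _ _ => by positivity
    _ = m * ∑ l ∈ Finset.range N, q ^ l := hblock N
    _ ≤ m * (1 / (1 - q)) := by
        refine mul_le_mul_of_nonneg_left ?_ (by positivity)
        rw [one_div, ← tsum_geometric_of_lt_one hq hq1]
        exact (summable_geometric_of_lt_one hq hq1).sum_le_tsum _ fun _ _ => by positivity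
    _ = m / (1 - q) := by ring

/-- The convolution of the step sizes with a summable rate, weighted by the decreasing step
sizes. -/
lemma sum_alpha_conv_le {γ : ℝ} (hγ : 1 / 2 < γ) (hγ' : γ < 1) {ρ : ℕ → ℝ} (hρ : ∀ k, 0 ≤ ρ k)
    {C : ℝ} (hC : ∀ N, ∑ k ∈ Finset.range N, ρ k ≤ C) (T : ℕ) :
    ∑ t ∈ Finset.range T, alpha γ (t + 1) * ∑ s ∈ Finset.range t, ρ (t - s) * alpha γ (s + 1)
      ≤ C * (1 + 1 / (2 * γ - 1)) := by
  have hC0 : 0 ≤ C := by simpa using hC 0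
  calc ∑ t ∈ Finset.range T, alpha γ (t + 1) * ∑ s ∈ Finset.range t, ρ (t - s) * alpha γ (s + 1)
      ≤ ∑ t ∈ Finset.range T, ∑ s ∈ Finset.range t, ρ (t - s) * alpha γ (s + 1) ^ 2 := by
        refine Finset.sum_le_sum fun t _ => ?_
        rw [Finset.mul_sum]
        refine Finset.sum_le_sum fun s hs => ?_
        have h1 := alpha_succ_anti (γ := γ) (by linarith) (Finset.mem_range.1 hs).le
        have h2 := mul_nonneg (hρ (t - s)) (alpha_nonneg γ (s + 1))
        calc alpha γ (t + 1) * (ρ (t - s) * alpha γ (s + 1))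
            ≤ alpha γ (s + 1) * (ρ (t - s) * alpha γ (s + 1)) := mul_le_mul_of_nonneg_right h1 h2
          _ = _ := by ring
    _ = ∑ s ∈ Finset.range T, ∑ t ∈ Finset.Ico (s + 1) T, ρ (t - s) * alpha γ (s + 1) ^ 2 := by
        refine Finset.sum_comm' fun t s => ?_
        simp only [Finset.mem_range, Finset.mem_Ico]
        omega
    _ ≤ ∑ s ∈ Finset.range T, C * alpha γ (s + 1) ^ 2 := by
        refine Finset.sum_le_sum fun s _ => ?_
        rw [← Finset.sum_mul]
        refine mul_le_mul_of_nonneg_right ?_ (sq_nonneg _)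
        calc ∑ t ∈ Finset.Ico (s + 1) T, ρ (t - s) ≤ ∑ t ∈ Finset.Ico s (s + T), ρ (t - s) :=
              Finset.sum_le_sum_of_subset_of_nonneg
                (Finset.Ico_subset_Ico (by omega) (by omega)) fun _ _ _ => hρ _
          _ = ∑ k ∈ Finset.range T, ρ k := by
              rw [Finset.sum_Ico_eq_sum_range]; simp
          _ ≤ C := hC T
    _ = C * ∑ s ∈ Finset.range T, alpha γ (s + 1) ^ 2 := by rw [Finset.mul_sum]
    _ ≤ _ := mul_le_mul_of_nonneg_left (sum_alpha_sq_le hγ hγ' T) hC0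

/-! ### Comparison with the rate `λ` -/

/-- Since `(1 - x) ^ e ≥ 1 - x` for exponents `e ≤ 1`, the gap `1 - λ` is at most
`n^{-4nB/p}`, which is far below the gap of the contraction rate. -/
lemma gap_comparison {n : ℕ} (hn : 2 ≤ n) {p : LoopDigraph n → ℝ} {π : ℝ} (hπ : 0 < π)
    (hπ1 : π ≤ 1) (hp : pConn p = π ^ (2 * n - 2)) :
    0 < 1 - lam p ∧ 4 * n * (n - 1) * (1 - lam p) ≤ 60 * (π ^ (n - 1) / (n : ℝ) ^ n) := by
  have hn2 : (2 : ℝ) ≤ n := by exact_mod_cast hn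
  set P := π ^ (n - 1) with hP
  have hP0 : 0 < P := by positivity
  have hP1 : P ≤ 1 := pow_le_one₀ hπ.le hπ1
  have hpc : pConn p = P ^ 2 := by
    rw [hp, hP, ← pow_mul]; congr 1; omega
  set E : ℝ := 4 * n * (2 * n - 2) / pConn p with hE
  set e : ℝ := pConn p / (2 * n * (2 * n - 2)) with he
  have hnn : 0 < (2 : ℝ) * n - 2 := by linarith
  have hP2 : P ^ 2 ≤ 1 := pow_le_one₀ hP0.le hP1
  have he0 : 0 < e := by rw [he, hpc]; positivity
  have he1 : e ≤ 1 := by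
    rw [he, hpc, div_le_one (by positivity)]
    nlinarith
  -- The exponent leaves room for `n ^ n`, for `n ^ 2` and for `1 / P ≤ n ^ (1 / P)`.
  have hEge : (n : ℝ) + 2 + 1 / P ≤ E := by
    rw [hE, hpc, le_div_iff₀ (by positivity)]
    have h1 : (n + 2 + 1 / P) * P ^ 2 = (n + 2) * P ^ 2 + P := by field_simp
    rw [h1]
    nlinarith
  have hE0 : 0 < E := by
    have : 0 < 1 / P := by positivity
    linarith
  set x : ℝ := 1 / (n : ℝ) ^ E with hx
  have hx0 : 0 < x := by positivity
  have hx1 : x < 1 := by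
    rw [hx, div_lt_one (by positivity)]
    exact Real.one_lt_rpow (by linarith) hE0
  have hlam : lam p = (1 - x) ^ e := rfl
  have hlt : lam p < 1 := by
    rw [hlam]
    exact Real.rpow_lt_one (by linarith) (by linarith) he0
  have hge : 1 - lam p ≤ x := by
    have := Real.rpow_le_rpow_of_exponent_ge (x := 1 - x) (by linarith) (by linarith) he1
    rw [Real.rpow_one] at this
    rw [hlam]; linarith
  have hxle : x ≤ P / ((n : ℝ) ^ n * n ^ 2) := by
    have h1 : (n : ℝ) ^ n * n ^ 2 * (1 / P) ≤ (n : ℝ) ^ E := by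
      calc (n : ℝ) ^ n * n ^ 2 * (1 / P) ≤ (n : ℝ) ^ n * n ^ 2 * (n : ℝ) ^ (1 / P) := by
            refine mul_le_mul_of_nonneg_left ?_ (by positivity)
            have h2 : 1 / P ≤ (2 : ℝ) ^ (1 / P) := by
              have h3 := one_add_mul_self_le_rpow_one_add (s := 1) (by norm_num)
                (p := 1 / P) (by rw [le_div_iff₀ hP0]; linarith)
              norm_num at h3 ⊢
              linarith
            exact h2.trans (Real.rpow_le_rpow (by norm_num) hn2 (by positivity))
        _ = (n : ℝ) ^ ((n : ℝ) + 2 + 1 / P) := by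
            rw [Real.rpow_add (by positivity), Real.rpow_add (by positivity), Real.rpow_natCast,
              Real.rpow_two]
        _ ≤ (n : ℝ) ^ E := Real.rpow_le_rpow_of_exponent_le (by linarith) hEge
    have h4 : P / ((n : ℝ) ^ n * n ^ 2) = 1 / ((n : ℝ) ^ n * n ^ 2 * (1 / P)) := by field_simp
    rw [h4, hx]
    exact one_div_le_one_div_of_le (by positivity) h1
  refine ⟨by linarith, ?_⟩
  calc 4 * n * (n - 1) * (1 - lam p) ≤ 4 * n * (n - 1) * (P / ((n : ℝ) ^ n * n ^ 2)) :=
        mul_le_mul_of_nonneg_left (hge.trans hxle) (by nlinarith)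
    _ = 4 * ((n - 1) / n) * (P / (n : ℝ) ^ n) := by field_simp
    _ ≤ 60 * (P / (n : ℝ) ^ n) := by
        refine mul_le_mul_of_nonneg_right ?_ (by positivity)
        have : ((n : ℝ) - 1) / n ≤ 1 := by rw [div_le_one (by positivity)]; linarith
        linarith

/-! ### Disagreement along one realization -/

section Spread

variable {n : ℕ} {V : Type*} [NormedAddCommGroup V] [NormedSpace ℝ V]

lemma RatiosWithin.sub {w : Fin n → ℝ} {v v' : Fin n → V} {D D' : ℝ} (h : RatiosWithin w v D)
    (h' : RatiosWithin w v' D') : RatiosWithin w (v - v') (D + D') := fun i j => by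
  calc ‖(1 / w i) • (v - v') i - (1 / w j) • (v - v') j‖
      = ‖((1 / w i) • v i - (1 / w j) • v j) - ((1 / w i) • v' i - (1 / w j) • v' j)‖ := by
        simp only [Pi.sub_apply, smul_sub]; congr 1; abel
    _ ≤ _ := (norm_sub_le _ _).trans (add_le_add (h i j) (h' i j))

lemma RatiosWithin.const_smul {w : Fin n → ℝ} {v : Fin n → V} {D a : ℝ} (ha : 0 ≤ a)
    (h : RatiosWithin w v D) : RatiosWithin w (a • v) (a * D) := fun i j => by
  rw [Pi.smul_apply, Pi.smul_apply, smul_comm _ a, smul_comm _ a, ← smul_sub, norm_smul,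
    Real.norm_of_nonneg ha]
  exact mul_le_mul_of_nonneg_left (h i j) ha

lemma RatiosWithin.sum {ι : Type*} {s : Finset ι} {w : Fin n → ℝ} {v : ι → Fin n → V} {D : ι → ℝ}
    (h : ∀ k ∈ s, RatiosWithin w (v k) (D k)) : RatiosWithin w (∑ k ∈ s, v k) (∑ k ∈ s, D k) :=
  fun i j => by
    simp only [Finset.sum_apply, Finset.smul_sum]
    rw [← Finset.sum_sub_distrib]
    exact norm_sum_le_of_le _ fun k hk => h k hk i j

lemma ratiosWithin_of_sum_norm_le (hn : 2 ≤ n) (G : ℕ → LoopDigraph n) (s : ℕ) {v : Fin n → V}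
    {X : ℝ} (hX : ∑ j, ‖v j‖ ≤ X) : RatiosWithin (y G s) v (2 * n / delta n * X) := by
  have hn0 : (0 : ℝ) < n := by exact_mod_cast (by omega : 0 < n)
  have hδ : 0 < delta n := by unfold delta; positivity
  have hone : ∀ i, ‖(1 / y G s i) • v i‖ ≤ n / delta n * X := fun i => by
    have hy := y_pos G hn s i
    have h1 : 1 / y G s i ≤ n / delta n := by
      rw [div_le_div_iff₀ hy hδ, one_mul, mul_comm, ← div_le_iff₀ hn0]
      exact delta_div_le_y G hn s i
    have h2 : ‖v i‖ ≤ X :=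
      (Finset.single_le_sum (f := fun j => ‖v j‖) (fun j _ => norm_nonneg _)
        (Finset.mem_univ i)).trans hX
    rw [norm_smul, Real.norm_of_nonneg (by positivity)]
    exact mul_le_mul h1 h2 (norm_nonneg _) (by positivity)
  intro i j
  calc _ ≤ n / delta n * X + n / delta n * X :=
        (norm_sub_le _ _).trans (add_le_add (hone i) (hone j))
    _ = _ := by ring

lemma matrix_smul_const_smul (M : Matrix (Fin n) (Fin n) ℝ) (a : ℝ) (v : Fin n → V) :
    M • (a • v) = a • (M • v) := by
  funext i
  simp only [Matrix.Module.smul_apply, Pi.smul_apply, Finset.smul_sum]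
  exact Finset.sum_congr rfl fun j _ => smul_comm _ _ _

end Spread

section Path

variable {n d : ℕ} {γ : ℝ} {G : ℕ → LoopDigraph n}
  {g : ℕ → Fin n → EuclideanSpace ℝ (Fin d)} {x0 : Fin n → EuclideanSpace ℝ (Fin d)}

lemma w_succ (t : ℕ) : w γ G g x0 (t + 1) = stepMatrix G t • x γ G g x0 t := push_eq_smul _ _

lemma x_succ (t : ℕ) :
    x γ G g x0 (t + 1) = w γ G g x0 (t + 1) - alpha γ (t + 1) • g (t + 1) := rfl

/-- The state before the subgradient step is a superposition of the transported initial state and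
the transported subgradient steps. -/
lemma w_eq (t : ℕ) : w γ G g x0 (t + 1) = transition G 0 (t + 1) • x0
    - ∑ s ∈ Finset.range t, alpha γ (s + 1) • (transition G (s + 1) (t - s) • g (s + 1)) := by
  induction t with
  | zero => rw [w_succ]; simp [transition, x]
  | succ t ih =>
    rw [w_succ, x_succ, ih, smul_sub, smul_sub, Finset.smul_sum, matrix_smul_const_smul,
      Finset.sum_range_succ, ← mul_smul, ← sub_sub]
    have h0 : transition G 0 (t + 1 + 1) = stepMatrix G (t + 1) * transition G 0 (t + 1) := by
      rw [transition, zero_add]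
    have h1 : transition G (t + 1) (t + 1 - t) = stepMatrix G (t + 1) := by
      rw [Nat.add_sub_cancel_left]
      simp [transition]
    rw [h0, h1]
    congr 2
    refine Finset.sum_congr rfl fun s hs => ?_
    have hs' := Finset.mem_range.1 hs
    have h2 : transition G (s + 1) (t + 1 - s)
        = stepMatrix G (t + 1) * transition G (s + 1) (t - s) := by
      rw [show t + 1 - s = (t - s) + 1 by omega, transition, show s + 1 + (t - s) = t + 1 by omega]
    rw [matrix_smul_const_smul, ← mul_smul, h2]

/-- The bound on the disagreement of the estimates at time `t + 1`, where `X` bounds the initial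
states and `ℓ` the subgradients. -/
noncomputable def spreadBound {n : ℕ} [Nonempty (Fin n)] (b : Fin n → ℕ → LoopDigraph n)
    (G : ℕ → LoopDigraph n) (γ X ℓ : ℝ) (t : ℕ) : ℝ :=
  2 * n / delta n * (factor b G 0 ((t + 1) / (n - 1)) * X
    + ∑ s ∈ Finset.range t, factor b G (s + 1) ((t - s) / (n - 1)) * alpha γ (s + 1) * ℓ)

lemma norm_z_sub_z_le [Nonempty (Fin n)] (hn : 2 ≤ n) {b : Fin n → ℕ → LoopDigraph n}
    (hreach : ∀ r, reach (b r) r (n - 1) = Set.univ) {X ℓ : ℝ} (hX : ∑ j, ‖x0 j‖ ≤ X)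
    (hℓ : ∀ s, ∑ j, ‖g (s + 1) j‖ ≤ ℓ) (t : ℕ) (i j : Fin n) :
    ‖z γ G g x0 (t + 1) i - z γ G g x0 (t + 1) j‖ ≤ spreadBound b G γ X ℓ t := by
  have h0 := (ratiosWithin_of_sum_norm_le hn G 0 hX).factor hn hreach (t + 1)
  have h1 : ∀ s ∈ Finset.range t, RatiosWithin (y G (t + 1))
      (alpha γ (s + 1) • (transition G (s + 1) (t - s) • g (s + 1)))
      (alpha γ (s + 1) * (factor b G (s + 1) ((t - s) / (n - 1)) * (2 * n / delta n * ℓ))) :=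
    fun s hs => by
      have hs' := Finset.mem_range.1 hs
      have h2 := ((ratiosWithin_of_sum_norm_le hn G (s + 1) (hℓ s)).factor hn hreach
        (t - s)).const_smul (alpha_nonneg γ (s + 1))
      rwa [show s + 1 + (t - s) = t + 1 by omega] at h2
  rw [zero_add] at h0
  have h3 := h0.sub (RatiosWithin.sum h1)
  rw [← w_eq] at h3
  refine (h3 i j).trans_eq ?_
  rw [spreadBound, mul_add, Finset.mul_sum]
  congr 1
  · ring
  · exact Finset.sum_congr rfl fun s _ => by ring

lemma average_x_succ (t : ℕ) : average (x γ G g x0 (t + 1))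
    = average (x γ G g x0 t) - (alpha γ (t + 1) / n) • ∑ j, g (t + 1) j := by
  rw [average, average, x_succ, w_succ]
  simp only [Pi.sub_apply, Finset.sum_sub_distrib, sum_stepMatrix_smul, Pi.smul_apply, smul_sub,
    ← Finset.smul_sum, smul_smul]
  congr 2
  ring

/-- The average state is a convex combination of the estimates, with weights `y i / n`. -/
lemma average_x_eq (hn : 2 ≤ n) (t : ℕ) : average (x γ G g x0 t)
    = ∑ i, (y G (t + 1) i / n) • z γ G g x0 (t + 1) i := by
  rw [average, ← sum_stepMatrix_smul G t, ← w_succ, Finset.smul_sum]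
  refine Finset.sum_congr rfl fun i _ => ?_
  have := (y_pos G hn (t + 1) i).ne'
  rw [z, smul_smul]
  congr 1
  field_simp

lemma norm_average_sub_z_le (hn : 2 ≤ n) {t : ℕ} {D : ℝ}
    (hD : ∀ i j, ‖z γ G g x0 (t + 1) i - z γ G g x0 (t + 1) j‖ ≤ D) (k : Fin n) :
    ‖average (x γ G g x0 t) - z γ G g x0 (t + 1) k‖ ≤ D := by
  have hn0 : (n : ℝ) ≠ 0 := by exact_mod_cast (by omega : n ≠ 0)
  have hsum : ∑ i, y G (t + 1) i / n = 1 := by rw [← Finset.sum_div, sum_y, div_self hn0]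
  have hz : z γ G g x0 (t + 1) k = ∑ i, (y G (t + 1) i / n) • z γ G g x0 (t + 1) k := by
    rw [← Finset.sum_smul, hsum, one_smul]
  rw [average_x_eq hn, hz, ← Finset.sum_sub_distrib]
  calc _ ≤ ∑ i, y G (t + 1) i / n * D := by
        refine norm_sum_le_of_le _ fun i _ => ?_
        have h0 : 0 ≤ y G (t + 1) i / n := div_nonneg (y_nonneg G _ i) (by positivity)
        rw [← smul_sub, norm_smul, Real.norm_of_nonneg h0]
        exact mul_le_mul_of_nonneg_left (hD i k) h0
    _ = D := by rw [← Finset.sum_mul, hsum, one_mul]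

end Path

/-! ### The subgradient inequality -/

section Descent

variable {n d : ℕ} {f : Fin n → EuclideanSpace ℝ (Fin d) → ℝ} {L : Fin n → NNReal}

lemma IsSubgradientAt.norm_le {f : EuclideanSpace ℝ (Fin d) → ℝ} {L : NNReal}
    (hL : LipschitzWith L f) {v a : EuclideanSpace ℝ (Fin d)} (h : IsSubgradientAt f v a) :
    ‖v‖ ≤ L := by
  have h1 := h (a + v)
  have h2 := hL.dist_le_mul (a + v) a
  rw [add_sub_cancel_left, real_inner_self_eq_norm_sq] at h1
  rw [Real.dist_eq, dist_eq_norm, add_sub_cancel_left] at h2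
  have h3 : ‖v‖ * ‖v‖ ≤ L * ‖v‖ := by
    have := le_abs_self (f (a + v) - f a)
    nlinarith
  rcases (norm_nonneg v).eq_or_lt with h0 | h0
  · rw [← h0]; positivity
  · exact le_of_mul_le_mul_right h3 h0

/-- One subgradient step from `a`, with the subgradients taken at points `ζ i` that are within `D`
of `a` and of each other. -/
lemma subgradient_step (hn : 2 ≤ n) (hL : ∀ i, LipschitzWith (L i) (f i))
    {v ζ : Fin n → EuclideanSpace ℝ (Fin d)} (hv : ∀ i, IsSubgradientAt (f i) (v i) (ζ i))
    {a : EuclideanSpace ℝ (Fin d)} {D : ℝ} (hD : ∀ i j, ‖ζ i - ζ j‖ ≤ D)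
    (ha : ∀ i, ‖a - ζ i‖ ≤ D) {α : ℝ} (hα : 0 ≤ α) (c : EuclideanSpace ℝ (Fin d)) (k : Fin n) :
    α * (objective f (ζ k) - objective f c) ≤ n / 2 * ‖a - c‖ ^ 2
      - n / 2 * ‖a - (α / n) • ∑ j, v j - c‖ ^ 2 + (∑ j, (L j : ℝ)) ^ 2 / (2 * n) * α ^ 2
      + 2 * (∑ j, (L j : ℝ)) * (α * D) := by
  have hn0 : (0 : ℝ) < n := by exact_mod_cast (by omega : 0 < n)
  have hterm : ∀ i, f i (ζ k) - f i c - 2 * L i * D ≤ inner ℝ (v i) (a - c) := fun i => by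
    have h1 := hv i c
    have h2 : |inner ℝ (v i) (a - ζ i)| ≤ L i * D :=
      (abs_real_inner_le_norm _ _).trans
        (mul_le_mul ((hv i).norm_le (hL i)) (ha i) (norm_nonneg _) (by positivity))
    have h3 : |f i (ζ k) - f i (ζ i)| ≤ L i * D := by
      rw [← Real.dist_eq]
      refine ((hL i).dist_le_mul _ _).trans (mul_le_mul_of_nonneg_left ?_ (by positivity))
      rw [dist_eq_norm]
      exact hD k i
    have h4 : inner ℝ (v i) (a - c) = inner ℝ (v i) (a - ζ i) - inner ℝ (v i) (c - ζ i) := by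
      rw [← inner_sub_right]; congr 1; abel
    have h5 := neg_abs_le (inner ℝ (v i) (a - ζ i))
    have h6 := le_abs_self (f i (ζ k) - f i (ζ i))
    rw [h4]
    linarith
  have hinner : objective f (ζ k) - objective f c - 2 * (∑ j, (L j : ℝ)) * D
      ≤ inner ℝ (∑ j, v j) (a - c) := by
    rw [sum_inner, objective, objective]
    refine le_trans (le_of_eq ?_) (Finset.sum_le_sum fun i _ => hterm i)
    rw [Finset.sum_sub_distrib, Finset.sum_sub_distrib, ← Finset.sum_mul, ← Finset.mul_sum]
  have hnorm : ‖∑ j, v j‖ ≤ ∑ j, (L j : ℝ) :=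
    norm_sum_le_of_le _ fun j _ => (hv j).norm_le (hL j)
  have hexp : ‖a - (α / n) • ∑ j, v j - c‖ ^ 2 = ‖a - c‖ ^ 2
      - 2 * (α / n) * inner ℝ (∑ j, v j) (a - c) + (α / n) ^ 2 * ‖∑ j, v j‖ ^ 2 := by
    rw [sub_right_comm, norm_sub_sq_real, norm_smul, inner_smul_right, real_inner_comm, mul_pow,
      Real.norm_eq_abs, sq_abs]
    ring
  rw [hexp]
  have hsq : ‖∑ j, v j‖ ^ 2 ≤ (∑ j, (L j : ℝ)) ^ 2 := pow_le_pow_left₀ (norm_nonneg _) hnorm 2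
  have e1 : n / 2 * ‖a - c‖ ^ 2 - n / 2 * (‖a - c‖ ^ 2
      - 2 * (α / n) * inner ℝ (∑ j, v j) (a - c) + (α / n) ^ 2 * ‖∑ j, v j‖ ^ 2)
      = α * inner ℝ (∑ j, v j) (a - c) - ‖∑ j, v j‖ ^ 2 / (2 * n) * α ^ 2 := by
    field_simp; ring
  rw [e1]
  have h7 := mul_le_mul_of_nonneg_left hinner hα
  have h8 : ‖∑ j, v j‖ ^ 2 / (2 * n) * α ^ 2 ≤ (∑ j, (L j : ℝ)) ^ 2 / (2 * n) * α ^ 2 := by gcongr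
  linarith

lemma convexOn_objective (hconv : ∀ i, ConvexOn ℝ Set.univ (f i)) :
    ConvexOn ℝ Set.univ (objective f) := by
  refine ⟨convex_univ, fun a _ b _ s t hs ht hst => ?_⟩
  simp only [objective, Finset.smul_sum]
  rw [← Finset.sum_add_distrib]
  exact Finset.sum_le_sum fun i _ => (hconv i).2 trivial trivial hs ht hst

lemma lipschitzWith_objective (hL : ∀ i, LipschitzWith (L i) (f i)) :
    LipschitzWith (∑ i, L i) (objective f) := by
  refine LipschitzWith.of_dist_le_mul fun a b => ?_
  rw [objective, objective, Real.dist_eq, ← Finset.sum_sub_distrib]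
  push_cast
  rw [Finset.sum_mul]
  refine (Finset.abs_sum_le_sum_abs _ _).trans (Finset.sum_le_sum fun i _ => ?_)
  rw [← Real.dist_eq]
  exact (hL i).dist_le_mul a b

variable {γ : ℝ} {G : ℕ → LoopDigraph n} {g : ℕ → Fin n → EuclideanSpace ℝ (Fin d)}
  {x0 : Fin n → EuclideanSpace ℝ (Fin d)}

lemma S_mul_objective_zTilde_le (hconv : ∀ i, ConvexOn ℝ Set.univ (f i))
    (zt0 : Fin n → EuclideanSpace ℝ (Fin d)) (k : Fin n) (C : ℝ) (T : ℕ) :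
    S γ T * (objective f (zTilde γ G g x0 zt0 T k) - C)
      ≤ ∑ t ∈ Finset.range T, alpha γ (t + 1) * (objective f (z γ G g x0 (t + 1) k) - C) := by
  induction T with
  | zero => simp [S]
  | succ T ih =>
    have hS : S γ (T + 1) = S γ T + alpha γ (T + 1) := Finset.sum_range_succ _ _
    have hpos := S_succ_pos γ T
    have hS0 : 0 ≤ S γ T := Finset.sum_nonneg fun s _ => alpha_nonneg γ (s + 1)
    have hα := alpha_nonneg γ (T + 1)
    have hz : zTilde γ G g x0 zt0 (T + 1) k
        = (alpha γ (T + 1) / S γ (T + 1)) • z γ G g x0 (T + 1) k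
          + (S γ T / S γ (T + 1)) • zTilde γ G g x0 zt0 T k := by
      simp only [zTilde]
      rw [smul_add, smul_smul, smul_smul, one_div_mul_eq_div, one_div_mul_eq_div]
    have hc := (convexOn_objective hconv).2 (Set.mem_univ (z γ G g x0 (T + 1) k))
      (Set.mem_univ (zTilde γ G g x0 zt0 T k)) (div_nonneg hα hpos.le) (div_nonneg hS0 hpos.le)
      (by rw [← add_div, add_comm, ← hS, div_self hpos.ne'])
    rw [← hz, smul_eq_mul, smul_eq_mul] at hc
    have h1 := mul_le_mul_of_nonneg_left hc hpos.le
    have h2 : S γ (T + 1) * (alpha γ (T + 1) / S γ (T + 1) * objective f (z γ G g x0 (T + 1) k)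
        + S γ T / S γ (T + 1) * objective f (zTilde γ G g x0 zt0 T k))
        = alpha γ (T + 1) * objective f (z γ G g x0 (T + 1) k)
          + S γ T * objective f (zTilde γ G g x0 zt0 T k) := by
      field_simp
    rw [h2] at h1
    rw [Finset.sum_range_succ]
    have h3 : S γ (T + 1) * C = S γ T * C + alpha γ (T + 1) * C := by rw [hS]; ring
    linarith

lemma sum_alpha_mul_objective_z_le (hn : 2 ≤ n) (hL : ∀ i, LipschitzWith (L i) (f i))
    (hg : ∀ t i, IsSubgradientAt (f i) (g (t + 1) i) (z γ G g x0 (t + 1) i)) {D : ℕ → ℝ}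
    (hD : ∀ t i j, ‖z γ G g x0 (t + 1) i - z γ G g x0 (t + 1) j‖ ≤ D t)
    (c : EuclideanSpace ℝ (Fin d)) (k : Fin n) (T : ℕ) :
    ∑ t ∈ Finset.range T, alpha γ (t + 1) * (objective f (z γ G g x0 (t + 1) k) - objective f c)
      ≤ n / 2 * ‖average x0 - c‖ ^ 2 - n / 2 * ‖average (x γ G g x0 T) - c‖ ^ 2
        + (∑ j, (L j : ℝ)) ^ 2 / (2 * n) * ∑ t ∈ Finset.range T, alpha γ (t + 1) ^ 2
        + 2 * (∑ j, (L j : ℝ)) * ∑ t ∈ Finset.range T, alpha γ (t + 1) * D t := by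
  induction T with
  | zero => simp [x]
  | succ T ih =>
    have h := subgradient_step hn hL (hg T) (hD T) (norm_average_sub_z_le hn (hD T))
      (alpha_nonneg γ (T + 1)) c k
    rw [← average_x_succ] at h
    rw [Finset.sum_range_succ, Finset.sum_range_succ, Finset.sum_range_succ, mul_add, mul_add]
    linarith

/-- The pathwise convergence bound, in terms of the disagreements `D t`. -/
lemma objective_zTilde_sub_le (hn : 2 ≤ n) (hconv : ∀ i, ConvexOn ℝ Set.univ (f i))
    (hL : ∀ i, LipschitzWith (L i) (f i)) (hγ : 1 / 2 < γ) (hγ' : γ < 1)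
    (hg : ∀ t i, IsSubgradientAt (f i) (g (t + 1) i) (z γ G g x0 (t + 1) i)) {D : ℕ → ℝ}
    (hD : ∀ t i j, ‖z γ G g x0 (t + 1) i - z γ G g x0 (t + 1) j‖ ≤ D t)
    (zt0 : Fin n → EuclideanSpace ℝ (Fin d)) (c : EuclideanSpace ℝ (Fin d)) (k : Fin n) (t : ℕ) :
    objective f (zTilde γ G g x0 zt0 (t + 1) k) - objective f c
      ≤ Gam γ t * (n * ‖average x0 - c‖ ^ 2 / 2
        + (1 + 1 / (2 * γ - 1)) * ((∑ j, (L j : ℝ)) ^ 2 / (2 * n))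
        + 2 * (∑ j, (L j : ℝ)) * ∑ s ∈ Finset.range (t + 1), alpha γ (s + 1) * D s) := by
  have h1 := S_mul_objective_zTilde_le (γ := γ) (G := G) (g := g) (x0 := x0) hconv zt0 k
    (objective f c) (t + 1)
  have h2 := sum_alpha_mul_objective_z_le hn hL hg hD c k (t + 1)
  have h3 := mul_le_mul_of_nonneg_left (sum_alpha_sq_le hγ hγ' (t + 1))
    (by positivity : 0 ≤ (∑ j, (L j : ℝ)) ^ 2 / (2 * n))
  have h4 : 0 ≤ (n : ℝ) / 2 * ‖average (x γ G g x0 (t + 1)) - c‖ ^ 2 := by positivity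
  set Q := n * ‖average x0 - c‖ ^ 2 / 2
        + (1 + 1 / (2 * γ - 1)) * ((∑ j, (L j : ℝ)) ^ 2 / (2 * n))
        + 2 * (∑ j, (L j : ℝ)) * ∑ s ∈ Finset.range (t + 1), alpha γ (s + 1) * D s with hQ
  have hSQ : S γ (t + 1) * (objective f (zTilde γ G g x0 zt0 (t + 1) k) - objective f c) ≤ Q := by
    rw [hQ]; linarith
  have hS := S_succ_pos γ t
  have hQ0 : 0 ≤ Q := by
    have hD0 : ∀ s, 0 ≤ D s := fun s => (norm_nonneg _).trans (hD s k k)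
    have : 0 < 2 * γ - 1 := by linarith
    have : 0 ≤ ∑ s ∈ Finset.range (t + 1), alpha γ (s + 1) * D s :=
      Finset.sum_nonneg fun s _ => mul_nonneg (alpha_nonneg γ _) (hD0 s)
    positivity
  calc _ ≤ 1 / S γ (t + 1) * Q := by
        rw [one_div, ← div_eq_inv_mul, le_div_iff₀ hS, mul_comm]; exact hSQ
    _ ≤ Gam γ t * Q := mul_le_mul_of_nonneg_right (one_div_S_le_Gam (by linarith) hγ' t) hQ0

end Descent

/-! ### Measurability of the estimates -/

section Measurability

variable {n d : ℕ} {Ω : Type*} [MeasurableSpace Ω] {G : ℕ → Ω → LoopDigraph n} {γ : ℝ}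
  {g : ℕ → Fin n → Ω → EuclideanSpace ℝ (Fin d)} {x0 : Fin n → EuclideanSpace ℝ (Fin d)}

lemma measurable_x (hG : ∀ t, Measurable (G t)) (hg : ∀ t i, Measurable (g t i)) (t : ℕ)
    (i : Fin n) : Measurable fun ω => x γ (fun s => G s ω) (fun s j => g s j ω) x0 t i := by
  induction t generalizing i with
  | zero => exact measurable_const
  | succ t ih =>
    have hM : ∀ j, Measurable fun ω => stepMatrix (fun s => G s ω) t i j := fun j =>
      measurable_of_congr hG (Φ := fun G => stepMatrix G t i j) (t := t + 1) fun _ _ h => by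
        rw [stepMatrix_congr h]
    have hsum : Measurable fun ω => ∑ j, stepMatrix (fun s => G s ω) t i j •
        x γ (fun s => G s ω) (fun s j => g s j ω) x0 t j :=
      Finset.measurable_fun_sum _ fun j _ => (hM j).smul (ih j)
    have hstep : Measurable fun ω => alpha γ (t + 1) • g (t + 1) i ω :=
      (hg (t + 1) i).const_smul (alpha γ (t + 1))
    simp only [x_succ, w_succ]
    exact hsum.sub hstep

lemma measurable_z_succ (hG : ∀ t, Measurable (G t)) (hg : ∀ t i, Measurable (g t i)) (t : ℕ)
    (i : Fin n) :
    Measurable fun ω => z γ (fun s => G s ω) (fun s j => g s j ω) x0 (t + 1) i := by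
  have hw : Measurable fun ω => w γ (fun s => G s ω) (fun s j => g s j ω) x0 (t + 1) i := by
    have hstep : Measurable fun ω => alpha γ (t + 1) • g (t + 1) i ω :=
      (hg (t + 1) i).const_smul (alpha γ (t + 1))
    have h := (measurable_x (γ := γ) (x0 := x0) hG hg (t + 1) i).add hstep
    have heq : (fun ω => w γ (fun s => G s ω) (fun s j => g s j ω) x0 (t + 1) i) = fun ω =>
        x γ (fun s => G s ω) (fun s j => g s j ω) x0 (t + 1) i + alpha γ (t + 1) • g (t + 1) i ω :=
      funext fun ω => by simp [x_succ]
    rw [heq]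
    exact h
  have hy : Measurable fun ω => y (fun s => G s ω) (t + 1) i :=
    measurable_of_congr hG (Φ := fun G => y G (t + 1) i) (t := t + 1) fun _ _ h => by
      rw [y_congr h]
  exact (measurable_const.div hy).smul hw

lemma measurable_zTilde (hG : ∀ t, Measurable (G t)) (hg : ∀ t i, Measurable (g t i))
    (zt0 : Fin n → EuclideanSpace ℝ (Fin d)) (t : ℕ) (i : Fin n) :
    Measurable fun ω => zTilde γ (fun s => G s ω) (fun s j => g s j ω) x0 zt0 t i := by
  induction t with
  | zero => exact measurable_const
  | succ t ih =>
    have h1 : Measurable fun ω => alpha γ (t + 1) •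
        z γ (fun s => G s ω) (fun s j => g s j ω) x0 (t + 1) i :=
      (measurable_z_succ hG hg t i).const_smul (alpha γ (t + 1))
    have h2 : Measurable fun ω => S γ t •
        zTilde γ (fun s => G s ω) (fun s j => g s j ω) x0 zt0 t i := ih.const_smul (S γ t)
    exact (h1.add h2).const_smul (1 / S γ (t + 1))

end Measurability

/-! ### The expected disagreement -/

section Expectation

variable {n : ℕ} [Nonempty (Fin n)] {Ω : Type*} [MeasurableSpace Ω] {μ : Measure Ω}
  [IsProbabilityMeasure μ] {G : ℕ → Ω → LoopDigraph n} {p : LoopDigraph n → ℝ}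

lemma integrable_spreadBound (hG : RandomGraphAssumption μ G p) (b : Fin n → ℕ → LoopDigraph n)
    (γ X ℓ : ℝ) (t : ℕ) : Integrable (fun ω => spreadBound b (fun s => G s ω) γ X ℓ t) μ := by
  unfold spreadBound
  exact (((integrable_factor hG b _ _).mul_const _).add (integrable_finsetSum _ fun s _ =>
    ((integrable_factor hG b _ _).mul_const _).mul_const _)).const_mul _

lemma integral_spreadBound_le (hG : RandomGraphAssumption μ G p)
    {b : Fin n → ℕ → LoopDigraph n} {π : ℝ} (hπ : 0 ≤ π) (hb : ∀ r k, π ≤ p (b r k))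
    (γ : ℝ) {X ℓ : ℝ} (hX : 0 ≤ X) (hℓ : 0 ≤ ℓ) (t : ℕ) :
    ∫ ω, spreadBound b (fun s => G s ω) γ X ℓ t ∂μ ≤ 2 * n / delta n *
      ((1 - π ^ (n - 1) / (n : ℝ) ^ n) ^ ((t + 1) / (n - 1)) * X
        + ∑ s ∈ Finset.range t, (1 - π ^ (n - 1) / (n : ℝ) ^ n) ^ ((t - s) / (n - 1))
          * alpha γ (s + 1) * ℓ) := by
  have hint : ∀ s ∈ Finset.range t, Integrable (fun ω =>
      factor b (fun t => G t ω) (s + 1) ((t - s) / (n - 1)) * alpha γ (s + 1) * ℓ) μ :=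
    fun s _ => ((integrable_factor hG b _ _).mul_const _).mul_const _
  have hδ : 0 ≤ delta n := by unfold delta; positivity
  unfold spreadBound
  rw [integral_const_mul, integral_add ((integrable_factor hG b _ _).mul_const _)
    (integrable_finsetSum _ hint), integral_finsetSum _ hint, integral_mul_const]
  simp only [integral_mul_const]
  gcongr with s _
  · exact integral_factor_le hG hπ hb _ _
  · exact alpha_nonneg γ _
  · exact integral_factor_le hG hπ hb _ _

lemma sum_alpha_mul_integral_spreadBound_le (hn : 2 ≤ n) (hG : RandomGraphAssumption μ G p)
    {b : Fin n → ℕ → LoopDigraph n} {π : ℝ} (hπ : 0 < π) (hπ1 : π ≤ 1)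
    (hb : ∀ r k, π ≤ p (b r k)) {γ : ℝ} (hγ : 1 / 2 < γ) (hγ' : γ < 1) {X ℓ : ℝ} (hX : 0 ≤ X)
    (hℓ : 0 ≤ ℓ) (T : ℕ) :
    ∑ t ∈ Finset.range T, alpha γ (t + 1) * ∫ ω, spreadBound b (fun s => G s ω) γ X ℓ t ∂μ
      ≤ 2 * n / delta n * ((n - 1) / (π ^ (n - 1) / (n : ℝ) ^ n))
        * (X + ℓ * (1 + 1 / (2 * γ - 1))) := by
  set κ := π ^ (n - 1) / (n : ℝ) ^ n with hκ
  have hn0 : 0 < (n : ℝ) := by exact_mod_cast (by omega : 0 < n)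
  have hκ0 : 0 < κ := by positivity
  have hκ1 : κ ≤ 1 := by
    have h1 : π ^ (n - 1) * (1 / (n : ℝ) ^ n) ≤ 1 :=
      mul_le_one₀ (pow_le_one₀ hπ.le hπ1) (by positivity) (one_div_pow_le_one n)
    rwa [mul_one_div] at h1
  have hδ : 0 ≤ delta n := by unfold delta; positivity
  set ρ : ℕ → ℝ := fun k => (1 - κ) ^ (k / (n - 1)) with hρ
  have hρ0 : ∀ k, 0 ≤ ρ k := fun k => pow_nonneg (by linarith) _
  have hR : ∀ N, ∑ k ∈ Finset.range N, ρ k ≤ (n - 1) / κ := fun N => by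
    have h := sum_pow_div_le (q := 1 - κ) (by linarith) (by linarith) (m := n - 1) (by omega) N
    rwa [sub_sub_cancel, Nat.cast_sub (by omega), Nat.cast_one] at h
  have hfirst : ∑ t ∈ Finset.range T, alpha γ (t + 1) * ρ (t + 1) ≤ (n - 1) / κ := by
    calc ∑ t ∈ Finset.range T, alpha γ (t + 1) * ρ (t + 1) ≤ ∑ t ∈ Finset.range T, ρ (t + 1) :=
          Finset.sum_le_sum fun t _ =>
            mul_le_of_le_one_left (hρ0 _) (alpha_succ_le_one (by linarith) t)
      _ ≤ ∑ k ∈ Finset.range (T + 1), ρ k := by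
          rw [Finset.sum_range_succ']; linarith [hρ0 0]
      _ ≤ _ := hR _
  have hsecond := sum_alpha_conv_le hγ hγ' hρ0 hR T
  calc _ ≤ ∑ t ∈ Finset.range T, alpha γ (t + 1) * (2 * n / delta n *
        (ρ (t + 1) * X + ∑ s ∈ Finset.range t, ρ (t - s) * alpha γ (s + 1) * ℓ)) :=
        Finset.sum_le_sum fun t _ => mul_le_mul_of_nonneg_left
          (integral_spreadBound_le hG hπ.le hb γ hX hℓ t) (alpha_nonneg γ _)
    _ = 2 * n / delta n * ((∑ t ∈ Finset.range T, alpha γ (t + 1) * ρ (t + 1)) * X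
        + (∑ t ∈ Finset.range T, alpha γ (t + 1) *
          ∑ s ∈ Finset.range t, ρ (t - s) * alpha γ (s + 1)) * ℓ) := by
        rw [Finset.sum_mul, Finset.sum_mul, ← Finset.sum_add_distrib, Finset.mul_sum]
        refine Finset.sum_congr rfl fun t _ => ?_
        rw [← Finset.sum_mul]
        ring
    _ ≤ 2 * n / delta n * ((n - 1) / κ * X + (n - 1) / κ * (1 + 1 / (2 * γ - 1)) * ℓ) := by
        gcongr
    _ = _ := by ring

end Expectation

lemma norm_le_norm1 {d : ℕ} (v : EuclideanSpace ℝ (Fin d)) : ‖v‖ ≤ norm1 v := by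
  have h0 : 0 ≤ norm1 v := Finset.sum_nonneg fun _ _ => abs_nonneg _
  rw [EuclideanSpace.norm_eq, Real.sqrt_le_left h0]
  exact Finset.sum_sq_le_sq_sum_of_nonneg fun l _ => abs_nonneg (v l)

/-- The smallest positive probability of a graph is attained, hence positive. -/
lemma exists_min_prob {n : ℕ} {Ω : Type*} [MeasurableSpace Ω] {μ : Measure Ω}
    [IsProbabilityMeasure μ] {G : ℕ → Ω → LoopDigraph n} {p : LoopDigraph n → ℝ}
    (hG : RandomGraphAssumption μ G p) {b₀ : LoopDigraph n} (hb₀ : 0 < p b₀) :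
    ∃ π, 0 < π ∧ π ≤ 1 ∧ (∀ b, 0 < p b → π ≤ p b) ∧ pConn p = π ^ (2 * n - 2) := by
  have : Nonempty {b : LoopDigraph n // 0 < p b} := ⟨⟨b₀, hb₀⟩⟩
  obtain ⟨b, hb⟩ := exists_eq_ciInf_of_finite (f := fun b : {b : LoopDigraph n // 0 < p b} => p b.1)
  refine ⟨_, hb ▸ b.2, ?_, fun b' hb' => ?_, rfl⟩
  · rw [← hb, ← hG.prob 0]
    exact measureReal_le_one
  · exact ciInf_le (Set.finite_range _).bddBelow (⟨b', hb'⟩ : {b : LoopDigraph n // 0 < p b})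

end MSP

theorem theorem2 {n d : ℕ} (hn : 2 ≤ n)
    {Ω : Type*} [MeasurableSpace Ω] (μ : Measure Ω) [IsProbabilityMeasure μ]
    (G : ℕ → Ω → MSP.LoopDigraph n) (p : MSP.LoopDigraph n → ℝ)
    (hG : MSP.RandomGraphAssumption μ G p)
    (f : Fin n → EuclideanSpace ℝ (Fin d) → ℝ) (hconv : ∀ i, ConvexOn ℝ Set.univ (f i))
    (L : Fin n → NNReal) (hL : ∀ i, LipschitzWith (L i) (f i))
    (γ : ℝ) (hγ : 1 / 2 < γ) (hγ' : γ < 1)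
    (x0 zt0 : Fin n → EuclideanSpace ℝ (Fin d))
    (g : ℕ → Fin n → Ω → EuclideanSpace ℝ (Fin d)) (hgm : ∀ t i, Measurable (g t i))
    (hg : ∀ ω t i, MSP.IsSubgradientAt (f i) (g (t + 1) i ω)
      (MSP.z γ (fun s => G s ω) (fun s j => g s j ω) x0 (t + 1) i))
    (i : Fin n) (zstar : EuclideanSpace ℝ (Fin d)) (hz : zstar ∈ MSP.minimizers f) :
    (∀ t : ℕ, 1 ≤ t →
      Integrable (fun ω => MSP.objective f
          (MSP.zTilde γ (fun s => G s ω) (fun s j => g s j ω) x0 zt0 (t + 1) i)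
        - MSP.objective f zstar) μ ∧
      ∫ ω, (MSP.objective f
          (MSP.zTilde γ (fun s => G s ω) (fun s j => g s j ω) x0 zt0 (t + 1) i)
        - MSP.objective f zstar) ∂μ ≤
        MSP.Gam γ t *
          (n * ‖MSP.average x0 - zstar‖ ^ 2 / 2
            + (1 + 1 / (2 * γ - 1)) * ((∑ j, (L j : ℝ)) ^ 2 / (2 * n))
            + 60 * (∑ j, (L j : ℝ)) * (∑ j, MSP.norm1 (x0 j)) / (MSP.delta n * (1 - MSP.lam p))
            + 60 * d * (∑ j, (L j : ℝ)) ^ 2 / (MSP.delta n * (1 - MSP.lam p))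
              * (1 + 1 / (2 * γ - 1)))) ∧
    (fun t : ℕ => ∫ ω, (MSP.objective f
          (MSP.zTilde γ (fun s => G s ω) (fun s j => g s j ω) x0 zt0 (t + 1) i)
        - MSP.objective f zstar) ∂μ) =O[Filter.atTop] (fun t : ℕ => (t : ℝ) ^ (-(1 - γ))) := by
  open MSP in
  have : Nonempty (Fin n) := ⟨i⟩
  choose b hbpos hreach using exists_reach_eq_univ hn hG.connected
  obtain ⟨π, hπ, hπ1, hπle, hpc⟩ := exists_min_prob hG (hbpos i 0)
  obtain ⟨hlam, hgap⟩ := gap_comparison hn hπ hπ1 hpc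
  have hbπ : ∀ r k, π ≤ p (b r k) := fun r k => hπle _ (hbpos r k)
  have hn2 : (2 : ℝ) ≤ n := by exact_mod_cast hn
  have hδ : 0 < delta n := by unfold delta; positivity
  have hL0 : 0 ≤ ∑ j, (L j : ℝ) := Finset.sum_nonneg fun j _ => (L j).2
  set X := ∑ j, norm1 (x0 j) with hXdef
  set ℓ := d * ∑ j, (L j : ℝ) with hℓdef
  have hX : ∑ j, ‖x0 j‖ ≤ X := Finset.sum_le_sum fun j _ => norm_le_norm1 _
  have hX0 : 0 ≤ X := (Finset.sum_nonneg fun j _ => norm_nonneg (x0 j)).trans hX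
  have hℓ0 : 0 ≤ ℓ := by positivity
  -- For `d = 0` the subgradients vanish, so the factor `d` costs nothing.
  have hgle : ∀ ω s, ∑ j, ‖g (s + 1) j ω‖ ≤ ℓ := fun ω s => by
    rw [hℓdef, Finset.mul_sum]
    refine Finset.sum_le_sum fun j _ => ?_
    rcases d.eq_zero_or_pos with rfl | hd
    · rw [Subsingleton.elim (g (s + 1) j ω) 0]; simp
    · exact ((hg ω s j).norm_le (hL j)).trans
        (le_mul_of_one_le_left (L j).2 (by exact_mod_cast hd))
  set A : ℝ := n * ‖average x0 - zstar‖ ^ 2 / 2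
    + (1 + 1 / (2 * γ - 1)) * ((∑ j, (L j : ℝ)) ^ 2 / (2 * n)) with hA
  have hpath : ∀ t ω, objective f
      (zTilde γ (fun s => G s ω) (fun s j => g s j ω) x0 zt0 (t + 1) i) - objective f zstar
      ≤ Gam γ t * (A + 2 * (∑ j, (L j : ℝ)) * ∑ s ∈ Finset.range (t + 1),
        alpha γ (s + 1) * spreadBound b (fun s => G s ω) γ X ℓ s) := fun t ω =>
    objective_zTilde_sub_le hn hconv hL hγ hγ' (hg ω)
      (norm_z_sub_z_le hn hreach hX (hgle ω)) zt0 zstar i t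
  have hsumint : ∀ t, Integrable (fun ω => ∑ s ∈ Finset.range (t + 1),
      alpha γ (s + 1) * spreadBound b (fun s => G s ω) γ X ℓ s) μ := fun t =>
    integrable_finsetSum _ fun s _ => (integrable_spreadBound hG b γ X ℓ s).const_mul _
  have hdomint : ∀ t, Integrable (fun ω => Gam γ t * (A + 2 * (∑ j, (L j : ℝ)) *
      ∑ s ∈ Finset.range (t + 1),
        alpha γ (s + 1) * spreadBound b (fun s => G s ω) γ X ℓ s)) μ := fun t =>
    ((integrable_const A).add ((hsumint t).const_mul _)).const_mul _
  have hnonneg : ∀ t ω, 0 ≤ objective f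
      (zTilde γ (fun s => G s ω) (fun s j => g s j ω) x0 zt0 (t + 1) i) - objective f zstar :=
    fun t ω => sub_nonneg.2 (hz _)
  have hint : ∀ t, Integrable (fun ω => objective f
      (zTilde γ (fun s => G s ω) (fun s j => g s j ω) x0 zt0 (t + 1) i)
        - objective f zstar) μ := fun t => by
    refine (hdomint t).mono' ?_ (Filter.Eventually.of_forall fun ω => ?_)
    · exact (((lipschitzWith_objective hL).continuous.measurable.comp
        (measurable_zTilde hG.measurable hgm zt0 (t + 1) i)).sub_const _).aestronglyMeasurable
    · rw [Real.norm_of_nonneg (hnonneg t ω)]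
      exact hpath t ω
  have hbound : ∀ t, ∫ ω, (objective f
      (zTilde γ (fun s => G s ω) (fun s j => g s j ω) x0 zt0 (t + 1) i) - objective f zstar) ∂μ
      ≤ Gam γ t * (A + 60 * (∑ j, (L j : ℝ)) * X / (delta n * (1 - lam p))
        + 60 * d * (∑ j, (L j : ℝ)) ^ 2 / (delta n * (1 - lam p)) * (1 + 1 / (2 * γ - 1))) :=
    fun t => by
      have hγ2 : 0 < 2 * γ - 1 := by linarith
      set κ := π ^ (n - 1) / (n : ℝ) ^ n with hκ
      have hκ0 : 0 < κ := by positivity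
      have hgap' : 4 * n * ((n - 1) / κ) ≤ 60 / (1 - lam p) := by
        rw [← mul_div_assoc, div_le_div_iff₀ hκ0 hlam]
        exact hgap
      have hE := sum_alpha_mul_integral_spreadBound_le hn hG hπ hπ1 hbπ hγ hγ' hX0 hℓ0 (t + 1)
      calc _ ≤ ∫ ω, Gam γ t * (A + 2 * (∑ j, (L j : ℝ)) * ∑ s ∈ Finset.range (t + 1),
            alpha γ (s + 1) * spreadBound b (fun s => G s ω) γ X ℓ s) ∂μ :=
            integral_mono (hint t) (hdomint t) (hpath t)
        _ = Gam γ t * (A + 2 * (∑ j, (L j : ℝ)) * ∑ s ∈ Finset.range (t + 1),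
            alpha γ (s + 1) * ∫ ω, spreadBound b (fun s => G s ω) γ X ℓ s ∂μ) := by
            rw [integral_const_mul, integral_add (integrable_const A) ((hsumint t).const_mul _),
              integral_const_mul, integral_finsetSum _ fun s _ =>
                (integrable_spreadBound hG b γ X ℓ s).const_mul _]
            simp [integral_const_mul]
        _ ≤ Gam γ t * (A + 2 * (∑ j, (L j : ℝ)) * (2 * n / delta n * ((n - 1) / κ)
            * (X + ℓ * (1 + 1 / (2 * γ - 1))))) := by
            have := Gam_nonneg hγ' t
            gcongr
        _ = Gam γ t * (A + 4 * n * ((n - 1) / κ) * ((∑ j, (L j : ℝ)) / delta n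
            * (X + ℓ * (1 + 1 / (2 * γ - 1))))) := by ring
        _ ≤ Gam γ t * (A + 60 / (1 - lam p) * ((∑ j, (L j : ℝ)) / delta n
            * (X + ℓ * (1 + 1 / (2 * γ - 1))))) := by
            have := Gam_nonneg hγ' t
            gcongr
        _ = _ := by
            rw [hℓdef]
            field_simp
            ring
  refine ⟨fun t _ => ⟨hint t, hbound t⟩, ?_⟩
  refine Asymptotics.IsBigO.trans (Asymptotics.IsBigO.of_bound
    (A + 60 * (∑ j, (L j : ℝ)) * X / (delta n * (1 - lam p))
      + 60 * d * (∑ j, (L j : ℝ)) ^ 2 / (delta n * (1 - lam p)) * (1 + 1 / (2 * γ - 1))) ?_)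
    (Gam_isBigO hγ')
  refine Filter.Eventually.of_forall fun t => ?_
  rw [Real.norm_of_nonneg (integral_nonneg fun ω => hnonneg t ω),
    Real.norm_of_nonneg (Gam_nonneg hγ' t), mul_comm]
  exact hbound t
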